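/- Conventions. Let $(X,\mathcal B,\mu)$ be a $\sigma$-finite measure space and $T:X\to X$ an invertible (bimeasurable) measure-preserving transformation. A *column* of height $h$ with base $B$ is a family of pairwise disjoint measurable sets $B,TB,\dots,T^{h-1}B$ (its *levels*). $T$ is *rank-one* if there are columns $C_n$ such that for every measurable $A$ with $\mu(A)<\infty$ and every $\varepsilon>0$ there is $N$ such that for every $n\ge N$ some union $U$ of levels of $C_n$ satisfies $\mu(A\,\triangle\,U)<\varepsilon$. A rank-one $T$ is given by *cutting and stacking* if $C_0$ is a single set of positive finite measure and $C_{n+1}$ is obtained from $C_n$ (of height $h_n$) by cutting it into $r_n\ge 2$ subcolumns of equal width, adding $s_{n,k}\ge 0$ new levels (spacers) above the $k$-th subcolumn, $0\le k<r_n$, and stacking each subcolumn with its spacers under the next one. Put $$H_n=\{0\}\cup\Big\{\sum_{k=0}^{i}(h_n+s_{n,k}) : 0\le i<r_n-1\Big\}.$$ $T$ is of *zero type* if $\mu(A\cap T^nA)\to 0$ for every measurable $A$ with $\mu(A)<\infty$; it is *multiply recurrent* if for every $k\in\mathbb N$ and every measurable $A$ with $\mu(A)>0$ there is $n\ge 1$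 with $\mu(A\cap T^nA\cap T^{2n}A\cap\dots\cap T^{kn}A)>0$. Proposition. Consider the cutting and stacking transformation $T$ with $C_0$ the unit interval (a set of measure $1$), $r_n=n+2$, no spacers on the first subcolumn ($s_{n,0}=0$), and the other spacer numbers chosen so that for all $n\ge 0$ $$H_n=\{0\}\cup\left\{j\cdot 5^{\frac{n(n+1)}2} : 1\le j\le\lceil\sqrt n\rceil\right\}\cup\left\{5^{\frac{n(n+1)}2+i} : \lceil\sqrt n\rceil\le i\le n\right\}.$$ Such a transformation exists; indeed it can be realized on $(0,\infty)$ with Lebesgue measure and $C_0=(0,1]$. Every such transformation $T$ on a $\sigma$-finite measure space is rank-one, of zero type, and multiply recurrent. Thus zero type does not preclude multiple recurrence in rank-one. -/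

import Mathlib

open MeasureTheory Set Filter
open scoped Topology ENNReal symmDiff

namespace RankOne

section Dynamics

variable {X : Type*} [MeasurableSpace X]

/-- The sets `B, T B, …, T^(h-1) B` form a Rokhlin column: they are measurable
(`T` is bimeasurable) and pairwise disjoint. -/
def IsColumn (T : X ≃ᵐ X) (B : Set X) (h : ℕ) : Prop :=
  MeasurableSet B ∧
    ∀ i < h, ∀ j < h, i ≠ j → Disjoint (T^[i] '' B) (T^[j] '' B)

/-- `T` is an invertible measure-preserving transformation that is rank-one along the columns
`C n` with base `B n` and height `h n`: every measurable set of finite measure is, for all large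
`n`, approximated in measure by unions of levels of `C n`. -/
structure IsRankOneAlong (μ : Measure X) (T : X ≃ᵐ X) (B : ℕ → Set X) (h : ℕ → ℕ) : Prop where
  measurePreserving : MeasurePreserving T μ μ
  isColumn : ∀ n, IsColumn T (B n) (h n)
  approx : ∀ A : Set X, MeasurableSet A → μ A < ∞ → ∀ ε : ℝ≥0∞, 0 < ε →
    ∃ N, ∀ n ≥ N, ∃ F : Finset ℕ, F ⊆ Finset.range (h n) ∧
      μ (A ∆ (⋃ i ∈ F, T^[i] '' B n)) < ε

/-- Rank-one transformations. -/
def IsRankOne (μ : Measure X) (T : X ≃ᵐ X) : Prop :=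
  ∃ (B : ℕ → Set X) (h : ℕ → ℕ), IsRankOneAlong μ T B h

/-- Zero type: `μ (A ∩ T^n A) → 0` for every `A` of finite measure. -/
def IsZeroType (μ : Measure X) (T : X ≃ᵐ X) : Prop :=
  ∀ A : Set X, MeasurableSet A → μ A < ∞ →
    Tendsto (fun n : ℕ => μ (A ∩ T^[n] '' A)) atTop (𝓝 0)

/-- `k`-recurrence: for every `A` of positive measure there is `n ≥ 1` such that
`A ∩ T^n A ∩ T^(2n) A ∩ … ∩ T^(kn) A` has positive measure. -/
def IsRecurrent (μ : Measure X) (T : X ≃ᵐ X) (k : ℕ) : Prop :=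
  ∀ A : Set X, MeasurableSet A → 0 < μ A →
    ∃ n : ℕ, 1 ≤ n ∧ 0 < μ (⋂ i ∈ Finset.range (k + 1), T^[i * n] '' A)

/-- Multiple recurrence: `k`-recurrence for every `k`. -/
def IsMultiplyRecurrent (μ : Measure X) (T : X ≃ᵐ X) : Prop :=
  ∀ k : ℕ, IsRecurrent μ T k

end Dynamics

/-- The height `h n` of the column `C n` when `C 0` is a single level and `C (n+1)` arises from
`C n` by cutting into `r n` subcolumns, putting `s n k` spacers above the `k`-th subcolumn
(`0 ≤ k < r n`) and stacking. -/
def height (r : ℕ → ℕ) (s : ℕ → ℕ → ℕ) : ℕ → ℕ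
  | 0 => 1
  | n + 1 => ∑ k ∈ Finset.range (r n), (height r s n + s n k)

/-- The height in `C (n+1)` at which the `k`-th subcolumn of `C n` starts. -/
def subcolumnHeight (r : ℕ → ℕ) (s : ℕ → ℕ → ℕ) (n k : ℕ) : ℕ :=
  ∑ j ∈ Finset.range k, (height r s n + s n j)

/-- The height set `H n = {0} ∪ {∑_{k ≤ i} (h n + s n k) : 0 ≤ i < r n - 1}`. -/
def heightSet (r : ℕ → ℕ) (s : ℕ → ℕ → ℕ) (n : ℕ) : Set ℕ :=
  {0} ∪ {m | ∃ i, i < r n - 1 ∧ m = ∑ k ∈ Finset.range (i + 1), (height r s n + s n k)}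

/-- `T` is the rank-one transformation obtained by cutting and stacking with `r n` cuts and
spacer numbers `s n k`, where `B n` is the base of the column `C n`.
The base `B n` is cut into the pieces `T^(subcolumnHeight r s n k) (B (n+1))`, `k < r n`, which are
pairwise disjoint and of equal measure because `C (n+1)` is a column and `T` preserves `μ`; the
levels of `C (n+1)` not lying in a copy of `C n` are the spacers. -/
structure IsCuttingStacking {X : Type*} [MeasurableSpace X] (μ : Measure X) (T : X ≃ᵐ X)
    (r : ℕ → ℕ) (s : ℕ → ℕ → ℕ) (B : ℕ → Set X) : Prop where
  two_le_cuts : ∀ n, 2 ≤ r n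
  base_pos : 0 < μ (B 0)
  base_lt_top : μ (B 0) < ∞
  cut : ∀ n, B n = ⋃ k ∈ Finset.range (r n), T^[subcolumnHeight r s n k] '' B (n + 1)
  isRankOneAlong : IsRankOneAlong μ T B (height r s)

/-- The number of cuts `r n = n + 2`. -/
def cuts (n : ℕ) : ℕ := n + 2

/-- The prescribed height sets: with `a = 5^(n(n+1)/2)` and `c = ⌈√n⌉`,
`{0} ∪ {a, 2a, …, ca} ∪ {5^c a, 5^(c+1) a, …, 5^n a}`. -/
def prescribedHeights (n : ℕ) : Set ℕ :=
  {0} ∪ {m | ∃ j, 1 ≤ j ∧ j ≤ ⌈Real.sqrt n⌉₊ ∧ m = j * 5 ^ (n * (n + 1) / 2)} ∪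
    {m | ∃ i, ⌈Real.sqrt n⌉₊ ≤ i ∧ i ≤ n ∧ m = 5 ^ (n * (n + 1) / 2 + i)}

/-- The spacer numbers `s` put no spacer on the first subcolumn and produce the
prescribed height sets. -/
def HasPrescribedHeights (s : ℕ → ℕ → ℕ) : Prop :=
  (∀ n, s n 0 = 0) ∧ ∀ n, heightSet cuts s n = prescribedHeights n

end RankOne

namespace RankOne

/-! ### Heights -/

section Heights

variable {r : ℕ → ℕ} {s : ℕ → ℕ → ℕ}

/-! Write `a = scale n` for the height of `C n`. The set `H n` is the union of a short arithmetic
progression of step `a`, which gives recurrence, and a long lacunary part of `a` times powers of 5,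
which gives zero type.

Zero type: `B 0` is covered by levels of `C n` at the heights `descendants s n`, the sums of
elements of `H 0, …, H (n-1)`. So `μ (B 0 ∩ T^k B 0)` is at most the number of representations of
`k` as a difference of descendants, divided by `(n+1)!`. Representation counts are submultiplicative
along the construction (`exists_diffCount_image₂_le`), and a nonzero difference in `H n` has only
`O(√n)` of the `n + 2` conceivable representations (`diffCount_heightFinset_le`). A large `k` must
use a nonzero difference at some late stage, which forces the ratio to be small. Approximation by
levels passes from `B 0` to every set of finite measure.

Multiple recurrence: if `A` violates `k`-recurrence, then on `k + 1` sublevels in arithmetic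
progression `A` has average density at most `k/(k+1)`. Such a progression starts every `H m` with `m
≥ k^2`. The sublevels outside it are cut again at later stages, and the fraction that is never
treated tends to 0 because `∏ (m+1)/(m+2)` diverges to 0. Hence `A` has density at most `k/(k+1)` in
every level of every late column, contradicting approximation by levels.

Existence: the levels of `C n` are cells of the grid of mesh `1/(n+1)!` on the half-line, ordered by
permutations `P n`; `T` translates each cell to the next one in this order. -/

theorem height_pos (hr : ∀ n, 0 < r n) (n : ℕ) : 0 < height r s n := by
  induction n with
  | zero => simp [height]
  | succ n ih =>
    rw [height]
    exact Finset.sum_pos (fun k _ => by omega) (by simpa using (hr n).ne')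

theorem subcolumnHeight_strictMono (hr : ∀ n, 0 < r n) (n : ℕ) :
    StrictMono (subcolumnHeight r s n) :=
  strictMono_nat_of_lt_succ fun k => by
    have := height_pos (s := s) hr n
    simp only [subcolumnHeight, Finset.sum_range_succ]
    omega

theorem subcolumnHeight_zero (n : ℕ) : subcolumnHeight r s n 0 = 0 := by
  simp [subcolumnHeight]

theorem subcolumnHeight_cuts (n : ℕ) :
    subcolumnHeight r s n (r n) = height r s (n + 1) := by
  simp [subcolumnHeight, height]

theorem subcolumnHeight_lt (hr : ∀ n, 0 < r n) {n k : ℕ} (hk : k < r n) :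
    subcolumnHeight r s n k < height r s (n + 1) := by
  rw [← subcolumnHeight_cuts]
  exact subcolumnHeight_strictMono hr n hk

theorem mem_heightSet_iff {n : ℕ} (hr : 0 < r n) {m : ℕ} :
    m ∈ heightSet r s n ↔ ∃ k < r n, subcolumnHeight r s n k = m := by
  constructor
  · rintro (h | ⟨i, hi, rfl⟩)
    · exact ⟨0, hr, by simpa [subcolumnHeight] using h.symm⟩
    · exact ⟨i + 1, by omega, rfl⟩
  · rintro ⟨k, hk, rfl⟩
    rcases k with _ | k
    · left; simp [subcolumnHeight]
    · right; exact ⟨k, by omega, rfl⟩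

/-- The set of heights at which the subcolumns start, as a finset. -/
def heightFinset (s : ℕ → ℕ → ℕ) (n : ℕ) : Finset ℕ :=
  (Finset.range (cuts n)).image (subcolumnHeight cuts s n)

/-- The number `5 ^ (n (n + 1) / 2)`, which is the height of the `n`-th column. -/
def scale (n : ℕ) : ℕ := 5 ^ (n * (n + 1) / 2)

theorem scale_pos (n : ℕ) : 0 < scale n := by unfold scale; positivity

theorem scale_succ (n : ℕ) : scale (n + 1) = 5 ^ (n + 1) * scale n := by
  unfold scale
  rw [← pow_add]
  congr 1
  rw [show (n + 1) * (n + 1 + 1) = (n + 1) * 2 + n * (n + 1) by ring]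
  omega

theorem lt_scale (n : ℕ) : n < scale n := by
  induction n with
  | zero => simp [scale]
  | succ n ih =>
    rw [scale_succ, pow_succ]
    nlinarith [Nat.one_le_pow n 5 (by norm_num)]

theorem ceil_sqrt_le (n : ℕ) : ⌈Real.sqrt n⌉₊ ≤ n := by
  rw [Nat.ceil_le, Real.sqrt_le_left (by positivity)]
  exact_mod_cast Nat.le_self_pow two_ne_zero n

theorem mem_prescribedHeights_iff {n m : ℕ} :
    m ∈ prescribedHeights n ↔
      (∃ j ≤ ⌈Real.sqrt n⌉₊, m = j * scale n) ∨
        ∃ i, ⌈Real.sqrt n⌉₊ ≤ i ∧ i ≤ n ∧ m = 5 ^ i * scale n := by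
  simp only [prescribedHeights, scale, mem_union, mem_singleton_iff, mem_ofPred_eq, pow_add,
    mul_comm (5 ^ (n * (n + 1) / 2))]
  constructor
  · rintro ((rfl | ⟨j, -, h, rfl⟩) | h)
    · exact Or.inl ⟨0, by simp⟩
    · exact Or.inl ⟨j, h, rfl⟩
    · exact Or.inr h
  · rintro (⟨j, h, rfl⟩ | h)
    · rcases Nat.eq_zero_or_pos j with rfl | hj
      · simp
      · exact Or.inl (Or.inr ⟨j, hj, h, rfl⟩)
    · exact Or.inr h

theorem cuts_pos (n : ℕ) : 0 < cuts n := by simp [cuts]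

theorem mem_heightFinset_iff (hs : HasPrescribedHeights s) {n m : ℕ} :
    m ∈ heightFinset s n ↔
      (∃ j ≤ ⌈Real.sqrt n⌉₊, m = j * scale n) ∨
        ∃ i, ⌈Real.sqrt n⌉₊ ≤ i ∧ i ≤ n ∧ m = 5 ^ i * scale n := by
  rw [← mem_prescribedHeights_iff, ← hs.2 n, mem_heightSet_iff (cuts_pos n)]
  simp [heightFinset]

theorem card_heightFinset (s : ℕ → ℕ → ℕ) (n : ℕ) : (heightFinset s n).card = n + 2 := by
  rw [heightFinset, Finset.card_image_of_injective _
    (subcolumnHeight_strictMono cuts_pos n).injective]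
  simp [cuts]

theorem dvd_of_mem_heightFinset (hs : HasPrescribedHeights s) {n m : ℕ}
    (hm : m ∈ heightFinset s n) : scale n ∣ m := by
  rcases (mem_heightFinset_iff hs).1 hm with ⟨j, -, rfl⟩ | ⟨i, -, -, rfl⟩ <;>
    exact Dvd.intro_left _ rfl

theorem le_of_mem_heightFinset (hs : HasPrescribedHeights s) {n m : ℕ}
    (hm : m ∈ heightFinset s n) : m ≤ 5 ^ n * scale n := by
  rcases (mem_heightFinset_iff hs).1 hm with ⟨j, hj, rfl⟩ | ⟨i, -, hi, rfl⟩
  · exact Nat.mul_le_mul_right _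
      ((hj.trans (ceil_sqrt_le n)).trans (Nat.lt_pow_self (by norm_num)).le)
  · exact Nat.mul_le_mul_right _ (Nat.pow_le_pow_right (by norm_num) hi)

/-- Without spacers on the first subcolumn, the second one starts at the column's height, which is
therefore the least positive element of `H n`. -/
theorem height_eq_scale (hs : HasPrescribedHeights s) (n : ℕ) : height cuts s n = scale n := by
  have h1 : subcolumnHeight cuts s n 1 = height cuts s n := by
    simp [subcolumnHeight, hs.1 n]
  have hmem : height cuts s n ∈ heightFinset s n := by
    rw [← h1]
    exact Finset.mem_image_of_mem _ (by simp [cuts])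
  apply le_antisymm
  · have : scale n ∈ heightFinset s n := by
      rw [mem_heightFinset_iff hs]
      rcases Nat.eq_zero_or_pos n with rfl | hn
      · right; exact ⟨0, by simp⟩
      · left
        refine ⟨1, ?_, by simp⟩
        rw [Nat.one_le_ceil_iff]
        positivity
    obtain ⟨k, -, hk⟩ := Finset.mem_image.1 this
    rw [← hk, ← h1]
    apply (subcolumnHeight_strictMono cuts_pos n).monotone
    by_contra h0
    obtain rfl : k = 0 := by omega
    have := scale_pos n
    rw [subcolumnHeight_zero] at hk
    omega
  · exact Nat.le_of_dvd (height_pos cuts_pos n) (dvd_of_mem_heightFinset hs hmem)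

/-- The heights in the `n`-th column of the levels that make up the base of the `0`-th column. -/
def descendants (s : ℕ → ℕ → ℕ) : ℕ → Finset ℕ
  | 0 => {0}
  | n + 1 => Finset.image₂ (· + ·) (descendants s n) (heightFinset s n)

theorem card_descendants_le (s : ℕ → ℕ → ℕ) (n : ℕ) :
    (descendants s n).card ≤ (n + 1).factorial := by
  induction n with
  | zero => simp [descendants]
  | succ n ih =>
    refine (Finset.card_image₂_le _ _ _).trans ?_
    rw [card_heightFinset, Nat.factorial_succ, mul_comm]
    exact Nat.mul_le_mul_left _ ih

theorem four_mul_le_of_mem_descendants (hs : HasPrescribedHeights s) {n m : ℕ}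
    (hm : m ∈ descendants s n) : 4 * m ≤ scale n := by
  induction n generalizing m with
  | zero => simp_all [descendants]
  | succ n ih =>
    obtain ⟨x, hx, y, hy, rfl⟩ := Finset.mem_image₂.1 hm
    have h1 := ih hx
    have h2 := le_of_mem_heightFinset hs hy
    rw [scale_succ, pow_succ]
    nlinarith [Nat.one_le_pow n 5 (by norm_num), scale_pos n]

end Heights

/-! ### Differences -/

section Differences

/-- The number of representations of `k` as a difference of two elements of `S`. -/
def diffCount (S : Finset ℕ) (k : ℤ) : ℕ :=
  ((S ×ˢ S).filter fun p => (p.1 : ℤ) - p.2 = k).card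

theorem diffCount_le_card (S : Finset ℕ) (k : ℤ) : diffCount S k ≤ S.card := by
  refine Finset.card_le_card_of_injOn Prod.fst (fun p hp => ?_) fun p hp q hq h => ?_
  · simp at hp; exact hp.1.1
  · simp at hp hq
    exact Prod.ext h (by have := hp.2; have := hq.2; omega)

/-- Differences of `D` are at most `a/4` in absolute value and differences of `H` are multiples of
`a`, so `k` determines its `H`-part `d`: two candidates would be multiples of `a` at distance at
most `a/2`. -/
theorem exists_diffCount_image₂_le {D H : Finset ℕ} {a : ℕ} (hD : ∀ x ∈ D, 4 * x ≤ a)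
    (ha : 0 < a) (hH : ∀ y ∈ H, a ∣ y) (k : ℤ) :
    ∃ d, diffCount (Finset.image₂ (· + ·) D H) k ≤ diffCount D (k - d) * diffCount H d := by
  classical
  by_cases hex : ∃ x ∈ D, ∃ x' ∈ D, ∃ y ∈ H, ∃ y' ∈ H, ((x + y : ℕ) : ℤ) - (x' + y' : ℕ) = k
  · obtain ⟨x, hx, x', hx', y, hy, y', hy', h⟩ := hex
    refine ⟨y - y', ?_⟩
    unfold diffCount
    rw [← Finset.card_product]
    refine (Finset.card_le_card ?_).trans
      (Finset.card_image_le (f := fun u : (ℕ × ℕ) × (ℕ × ℕ) => (u.1.1 + u.2.1, u.1.2 + u.2.2)))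
    rintro ⟨p, q⟩ hpq
    simp only [Finset.mem_filter, Finset.mem_product, Finset.mem_image₂] at hpq
    obtain ⟨⟨⟨u, hu, v, hv, rfl⟩, u', hu', v', hv', rfl⟩, hpq⟩ := hpq
    simp only [Finset.mem_image, Finset.mem_product, Finset.mem_filter]
    refine ⟨((u, u'), (v, v')), ?_, rfl⟩
    have key : (v : ℤ) - v' = y - y' := by
      have h1 : (a : ℤ) ∣ (v - v') - (y - y') :=
        ((Int.natCast_dvd_natCast.2 (hH v hv)).sub (Int.natCast_dvd_natCast.2 (hH v' hv'))).sub
          ((Int.natCast_dvd_natCast.2 (hH y hy)).sub (Int.natCast_dvd_natCast.2 (hH y' hy')))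
      have := hD x hx
      have := hD x' hx'
      have := hD u hu
      have := hD u' hu'
      have := Int.eq_zero_of_abs_lt_dvd h1 (by rw [abs_lt]; push_cast at h hpq; omega)
      omega
    push_cast at hpq
    exact ⟨⟨⟨hu, hu'⟩, by simp only; omega⟩, ⟨hv, hv'⟩, key⟩
  · refine ⟨0, ?_⟩
    have : diffCount (Finset.image₂ (· + ·) D H) k = 0 := by
      unfold diffCount
      rw [Finset.card_eq_zero, Finset.filter_eq_empty_iff]
      rintro ⟨p, q⟩ hpq h
      simp only [Finset.mem_product, Finset.mem_image₂] at hpq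
      obtain ⟨⟨u, hu, v, hv, rfl⟩, u', hu', v', hv', rfl⟩ := hpq
      exact hex ⟨u, hu, u', hu', v, hv, v', hv', h⟩
    simp [this]

/-- The larger power dominates: distinct powers of 5 differ at least by a factor of 5, so powers of
5 form a Sidon set. -/
theorem five_pow_diff_unique {i j i' j' : ℕ} (hij : i ≠ j)
    (h : (5 : ℤ) ^ i - 5 ^ j = 5 ^ i' - 5 ^ j') : i = i' ∧ j = j' := by
  have mono : ∀ {p q : ℕ}, p < q → (5 : ℤ) * 5 ^ p ≤ 5 ^ q := fun {p q} hpq => by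
    rw [← pow_succ']; exact pow_le_pow_right₀ (by norm_num) hpq
  have pos : ∀ p : ℕ, (0 : ℤ) < 5 ^ p := fun p => by positivity
  have := pos i; have := pos j; have := pos i'; have := pos j'
  rcases lt_trichotomy i i' with h1 | rfl | h1
  · have := mono h1
    rcases lt_trichotomy j j' with h2 | rfl | h2
    · have := mono h2
      rcases lt_trichotomy i' j' with h3 | h3 | h3
      · have := mono h3; omega
      · rw [h3] at h
        exact absurd (pow_right_injective₀ (a := (5 : ℤ)) (by norm_num) (by norm_num)
          (sub_eq_zero.1 (h.trans (sub_self _)))) hij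
      · have := mono h3; omega
    · omega
    · have := mono h2; omega
  · exact ⟨rfl, pow_right_injective₀ (a := (5 : ℤ)) (by norm_num) (by norm_num) (by simpa using h)⟩
  · have := mono h1
    rcases lt_trichotomy j j' with h2 | rfl | h2
    · have := mono h2; omega
    · omega
    · have := mono h2
      rcases lt_or_gt_of_ne hij with h3 | h3
      · have := mono h3; omega
      · have := mono h3; omega

/-- A pair with difference `d` is determined by either coordinate, so at most `c + 1` pairs have
their first entry in the progression and at most `c + 1` their second; among pairs of powers at most
one remains. -/
theorem diffCount_heightFinset_le {s : ℕ → ℕ → ℕ} (hs : HasPrescribedHeights s) (n : ℕ) {d : ℤ}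
    (hd : d ≠ 0) : diffCount (heightFinset s n) d ≤ 2 * ⌈Real.sqrt n⌉₊ + 3 := by
  classical
  set c := ⌈Real.sqrt n⌉₊ with hc
  let small : Finset ℕ := (Finset.range (c + 1)).image (· * scale n)
  have hsmall : small.card ≤ c + 1 := Finset.card_image_le.trans (by simp)
  have hmem : ∀ m ∈ heightFinset s n, m ∈ small ∨ ∃ i, m = 5 ^ i * scale n := by
    intro m hm
    rcases (mem_heightFinset_iff hs).1 hm with ⟨j, hj, rfl⟩ | ⟨i, -, -, rfl⟩
    · exact Or.inl (Finset.mem_image_of_mem _ (by simpa [Nat.lt_succ_iff] using hj))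
    · exact Or.inr ⟨i, rfl⟩
  set P := (heightFinset s n ×ˢ heightFinset s n).filter fun p => (p.1 : ℤ) - p.2 = d with hP
  have hPd : ∀ p ∈ P, (p.1 : ℤ) - p.2 = d := fun p hp => (Finset.mem_filter.1 hp).2
  have h1 : (P.filter fun p => p.1 ∈ small).card ≤ c + 1 := by
    refine (Finset.card_le_card_of_injOn (t := small) Prod.fst (fun p hp => ?_)
      fun p hp q hq h => ?_).trans hsmall
    · simp at hp; exact hp.2
    · have h2 := hPd p (Finset.mem_filter.1 hp).1
      have h3 := hPd q (Finset.mem_filter.1 hq).1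
      exact Prod.ext h (by omega)
  have h2 : (P.filter fun p => p.2 ∈ small).card ≤ c + 1 := by
    refine (Finset.card_le_card_of_injOn (t := small) Prod.snd (fun p hp => ?_)
      fun p hp q hq h => ?_).trans hsmall
    · simp at hp; exact hp.2
    · have h2 := hPd p (Finset.mem_filter.1 hp).1
      have h3 := hPd q (Finset.mem_filter.1 hq).1
      exact Prod.ext (by omega) h
  have h3 : (P.filter fun p => p.1 ∉ small ∧ p.2 ∉ small).card ≤ 1 := by
    rw [Finset.card_le_one]
    rintro ⟨p, q⟩ hp ⟨p', q'⟩ hp'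
    rw [Finset.mem_filter] at hp hp'
    obtain ⟨hp, hps, hqs⟩ := hp
    obtain ⟨hp', hps', hqs'⟩ := hp'
    have e := hPd _ hp
    have e' := hPd _ hp'
    simp only [hP, Finset.mem_filter, Finset.mem_product] at hp hp'
    obtain ⟨i, rfl⟩ := (hmem p hp.1.1).resolve_left hps
    obtain ⟨j, rfl⟩ := (hmem q hp.1.2).resolve_left hqs
    obtain ⟨i', rfl⟩ := (hmem p' hp'.1.1).resolve_left hps'
    obtain ⟨j', rfl⟩ := (hmem q' hp'.1.2).resolve_left hqs'
    have ha : (scale n : ℤ) ≠ 0 := by exact_mod_cast (scale_pos n).ne'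
    push_cast at e e'
    have hij : i ≠ j := by
      rintro rfl
      exact hd (by rw [← e, sub_self])
    have := five_pow_diff_unique (i' := i') (j' := j') hij
      (mul_right_cancel₀ ha (by rw [sub_mul, sub_mul, e, e']))
    rw [this.1, this.2]
  have hcover : P ⊆ (P.filter fun p => p.1 ∈ small) ∪ ((P.filter fun p => p.2 ∈ small) ∪
      P.filter fun p => p.1 ∉ small ∧ p.2 ∉ small) := by
    intro p hp
    simp only [Finset.mem_union, Finset.mem_filter]
    tauto
  calc diffCount (heightFinset s n) d = P.card := rfl
    _ ≤ _ := Finset.card_le_card hcover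
    _ ≤ _ := Finset.card_union_le _ _
    _ ≤ _ := Nat.add_le_add_left (Finset.card_union_le _ _) _
    _ ≤ 2 * c + 3 := by omega

theorem diffCount_descendants_le {s : ℕ → ℕ → ℕ} (hs : HasPrescribedHeights s) {ρ : ℝ} {m : ℕ}
    (hρ : ∀ n ≥ m, (2 * ⌈Real.sqrt n⌉₊ + 3 : ℝ) ≤ ρ * (n + 2)) {k : ℤ}
    (hk : (scale m : ℤ) < k) {n : ℕ} (hn : m ≤ n) :
    (diffCount (descendants s n) k : ℝ) ≤ ρ * (n + 1).factorial := by
  have hρ0 : 0 ≤ ρ := by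
    have := hρ m le_rfl
    by_contra! h
    nlinarith [(Nat.cast_nonneg m : (0 : ℝ) ≤ m), (Nat.cast_nonneg ⌈Real.sqrt m⌉₊ : (0 : ℝ) ≤ _)]
  induction n, hn using Nat.le_induction with
  | base =>
    have : diffCount (descendants s m) k = 0 := by
      unfold diffCount
      rw [Finset.card_eq_zero, Finset.filter_eq_empty_iff]
      rintro ⟨p, q⟩ hpq h
      have := four_mul_le_of_mem_descendants hs (Finset.mem_product.1 hpq).1
      simp only at h this
      omega
    rw [this, Nat.cast_zero]
    positivity
  | succ n hn ih =>
    obtain ⟨d, hd⟩ := exists_diffCount_image₂_le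
      (fun x hx => four_mul_le_of_mem_descendants hs hx) (scale_pos n)
      (fun y hy => dvd_of_mem_heightFinset hs hy) k
    have hd' : (diffCount (descendants s (n + 1)) k : ℝ) ≤
        diffCount (descendants s n) (k - d) * diffCount (heightFinset s n) d := by
      exact_mod_cast hd
    refine hd'.trans ?_
    rw [Nat.factorial_succ (n + 1)]
    push_cast
    -- If stage `n` contributes nothing to `k`, the ratio to the factorial carries over from the
    -- previous stage. Otherwise stage `n` alone supplies the factor `ρ`, and the trivial bound is
    -- enough for the earlier stages.
    by_cases h0 : d = 0
    · subst h0
      rw [sub_zero]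
      have : (diffCount (heightFinset s n) 0 : ℝ) ≤ n + 2 := by
        exact_mod_cast (diffCount_le_card _ _).trans (card_heightFinset s n).le
      calc _ ≤ ρ * (n + 1).factorial * (n + 2) := by gcongr
        _ = _ := by ring
    · have h1 : (diffCount (heightFinset s n) d : ℝ) ≤ ρ * (n + 2) :=
        le_trans (by exact_mod_cast diffCount_heightFinset_le hs n h0) (hρ n hn)
      have h2 : (diffCount (descendants s n) (k - d) : ℝ) ≤ (n + 1).factorial := by
        exact_mod_cast (diffCount_le_card _ _).trans (card_descendants_le s n)
      calc _ ≤ ((n + 1).factorial : ℝ) * (ρ * (n + 2)) := by gcongr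
        _ = _ := by ring

end Differences

/-! ### Levels of the columns -/

section Levels

variable {X : Type*} [MeasurableSpace X] {μ : Measure X} {T : X ≃ᵐ X}

theorem image_iterate_add (T : X ≃ᵐ X) (m n : ℕ) (A : Set X) :
    T^[m + n] '' A = T^[m] '' (T^[n] '' A) := by
  rw [Function.iterate_add, image_comp]

theorem iterate_injective (T : X ≃ᵐ X) (n : ℕ) : Function.Injective T^[n] :=
  T.injective.iterate n

theorem measurableSet_iterate_image (T : X ≃ᵐ X) (n : ℕ) {A : Set X} (hA : MeasurableSet A) :
    MeasurableSet (T^[n] '' A) := by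
  induction n with
  | zero => simpa
  | succ n ih =>
    rw [Function.iterate_succ', image_comp]
    exact T.measurableSet_image.2 ih

theorem measure_iterate_image (hT : MeasurePreserving T μ μ) (n : ℕ) (A : Set X) :
    μ (T^[n] '' A) = μ A := by
  induction n with
  | zero => simp
  | succ n ih =>
    rw [Function.iterate_succ', image_comp, ← ih,
      ← hT.measure_preimage_emb T.measurableEmbedding (T '' _), preimage_image_eq _ T.injective]

theorem measureReal_iterate_image (hT : MeasurePreserving T μ μ) (n : ℕ) (A : Set X) :
    μ.real (T^[n] '' A) = μ.real A := by
  rw [measureReal_def, measure_iterate_image hT, measureReal_def]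

variable {r : ℕ → ℕ} {s : ℕ → ℕ → ℕ} {B : ℕ → Set X}

namespace IsCuttingStacking

variable (h : IsCuttingStacking μ T r s B)
include h

theorem pos_cuts (n : ℕ) : 0 < r n := two_pos.trans_le (h.two_le_cuts n)

theorem measurableSet_base (n : ℕ) : MeasurableSet (B n) := (h.isRankOneAlong.isColumn n).1

theorem base_succ_subset (n : ℕ) : B (n + 1) ⊆ B n := by
  rw [h.cut n]
  intro x hx
  simp only [mem_iUnion]
  exact ⟨0, by simpa using h.pos_cuts n, by simpa [subcolumnHeight_zero] using hx⟩

theorem base_subset (n : ℕ) : B n ⊆ B 0 := by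
  induction n with
  | zero => exact Subset.rfl
  | succ n ih => exact (h.base_succ_subset n).trans ih

theorem base_ne_top (n : ℕ) : μ (B n) ≠ ∞ :=
  ((measure_mono (h.base_subset n)).trans_lt h.base_lt_top).ne

theorem measureReal_base_inter (n : ℕ) {A : Set X} (hA : MeasurableSet A) (i : ℕ) :
    μ.real (A ∩ T^[i] '' B n) = ∑ k ∈ Finset.range (r n),
      μ.real (A ∩ T^[i + subcolumnHeight r s n k] '' B (n + 1)) := by
  rw [h.cut n, image_iUnion₂, inter_iUnion₂]
  simp only [← image_iterate_add]
  have hT := h.isRankOneAlong.measurePreserving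
  refine measureReal_biUnion_finset ?_ (fun k _ => hA.inter
    (measurableSet_iterate_image T _ (h.measurableSet_base _))) fun k _ => ?_
  · intro k hk l hl hkl
    refine Disjoint.mono inter_subset_right inter_subset_right ?_
    rw [image_iterate_add, image_iterate_add]
    refine (disjoint_image_iff (iterate_injective T i)).2 ?_
    simp only [Finset.coe_range, mem_Iio] at hk hl
    exact (h.isRankOneAlong.isColumn (n + 1)).2 _ (subcolumnHeight_lt h.pos_cuts hk) _
      (subcolumnHeight_lt h.pos_cuts hl)
      ((subcolumnHeight_strictMono h.pos_cuts n).injective.ne hkl)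
  · refine ((measure_mono inter_subset_right).trans_lt ?_).ne
    rw [measure_iterate_image hT]
    exact (h.base_ne_top _).lt_top

theorem measureReal_base_eq (n : ℕ) : μ.real (B n) = r n * μ.real (B (n + 1)) := by
  have := h.measureReal_base_inter n MeasurableSet.univ 0
  simpa [measureReal_iterate_image h.isRankOneAlong.measurePreserving] using this

end IsCuttingStacking

theorem measureReal_base (h : IsCuttingStacking μ T cuts s B) (h0 : μ (B 0) = 1) (n : ℕ) :
    μ.real (B n) = 1 / (n + 1).factorial := by
  induction n with
  | zero => simp [measureReal_def, h0]
  | succ n ih =>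
    have := h.measureReal_base_eq n
    rw [ih] at this
    rw [div_eq_iff (by positivity), cuts] at this
    rw [Nat.factorial_succ, eq_div_iff (by positivity), this]
    push_cast
    ring

/-! ### Zero type -/

theorem base_zero_subset (h : IsCuttingStacking μ T cuts s B) (n : ℕ) :
    B 0 ⊆ ⋃ x ∈ descendants s n, T^[x] '' B n := by
  induction n with
  | zero => simp [descendants]
  | succ n ih =>
    refine ih.trans (iUnion₂_subset fun x hx => ?_)
    rw [h.cut n, image_iUnion₂]
    refine iUnion₂_subset fun k hk => ?_
    rw [← image_iterate_add]
    exact subset_biUnion_of_mem (u := fun x => T^[x] '' B (n + 1))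
      (show x + subcolumnHeight cuts s n k ∈ descendants s (n + 1) from
        Finset.mem_image₂_of_mem hx (Finset.mem_image_of_mem _ hk))

theorem measureReal_base_inter_iterate_le (h : IsCuttingStacking μ T cuts s B)
    (hs : HasPrescribedHeights s) (h0 : μ (B 0) = 1) {k n : ℕ} (hkn : 2 * k ≤ scale n) :
    μ.real (B 0 ∩ T^[k] '' B 0) ≤ diffCount (descendants s n) k / (n + 1).factorial := by
  classical
  have hT := h.isRankOneAlong.measurePreserving
  set P := (descendants s n ×ˢ descendants s n).filter fun p => (p.1 : ℤ) - p.2 = k with hP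
  have hsub : B 0 ∩ T^[k] '' B 0 ⊆ ⋃ p ∈ P, T^[p.1] '' B n := by
    rintro x ⟨hx, y, hy, rfl⟩
    obtain ⟨d, hd, hxd⟩ := mem_iUnion₂.1 (base_zero_subset h n hx)
    obtain ⟨e, he, hye⟩ := mem_iUnion₂.1 (base_zero_subset h n hy)
    have hke : T^[k] y ∈ T^[k + e] '' B n := by
      rw [image_iterate_add]; exact mem_image_of_mem _ hye
    have hd4 := four_mul_le_of_mem_descendants hs hd
    have he4 := four_mul_le_of_mem_descendants hs he
    have hpos := scale_pos n
    -- Both heights lie below the top of the column, since `k + e ≤ (1/2 + 1/4) * scale n`; distinct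
    -- levels would be disjoint.
    have hde : d = k + e := by
      by_contra hne
      exact ((h.isRankOneAlong.isColumn n).2 d (by rw [height_eq_scale hs]; omega) (k + e)
        (by rw [height_eq_scale hs]; omega) hne).le_bot ⟨hxd, hke⟩
    refine mem_iUnion₂.2 ⟨(d, e), ?_, hxd⟩
    simp only [hP, Finset.mem_filter, Finset.mem_product]
    exact ⟨⟨hd, he⟩, by omega⟩
  have hfin : μ (⋃ p ∈ P, T^[p.1] '' B n) ≠ ∞ := by
    refine (measure_biUnion_lt_top P.finite_toSet fun p _ => ?_).ne
    rw [measure_iterate_image hT]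
    exact (h.base_ne_top n).lt_top
  calc μ.real (B 0 ∩ T^[k] '' B 0) ≤ μ.real (⋃ p ∈ P, T^[p.1] '' B n) := measureReal_mono hsub hfin
    _ ≤ ∑ p ∈ P, μ.real (T^[p.1] '' B n) := measureReal_biUnion_finset_le _ _
    _ = P.card * (1 / (n + 1).factorial) := by
      simp [measureReal_iterate_image hT, measureReal_base h h0]
    _ = _ := by rw [mul_one_div]; rfl

theorem eventually_ceil_sqrt_le {ρ : ℝ} (hρ : 0 < ρ) :
    ∀ᶠ n : ℕ in atTop, (2 * ⌈Real.sqrt n⌉₊ + 3 : ℝ) ≤ ρ * (n + 2) := by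
  have h1 : Tendsto (fun n : ℕ => Real.sqrt n) atTop atTop :=
    Real.tendsto_sqrt_atTop.comp tendsto_natCast_atTop_atTop
  -- The left side is at most `2√n + 5 ≤ 7√n`, and `7√n ≤ ρ n`.
  filter_upwards [h1.eventually_ge_atTop 5, h1.eventually_ge_atTop (7 / ρ)] with n hn hn'
  have h2 := Nat.ceil_lt_add_one (Real.sqrt_nonneg n)
  have h3 := Real.mul_self_sqrt (Nat.cast_nonneg (α := ℝ) n)
  have h4 : 7 ≤ ρ * Real.sqrt n := by rwa [div_le_iff₀' hρ] at hn'
  nlinarith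

theorem tendsto_base_inter (h : IsCuttingStacking μ T cuts s B) (hs : HasPrescribedHeights s)
    (h0 : μ (B 0) = 1) : Tendsto (fun k : ℕ => μ (B 0 ∩ T^[k] '' B 0)) atTop (𝓝 0) := by
  have hfin : ∀ k : ℕ, μ (B 0 ∩ T^[k] '' B 0) ≠ ∞ := fun k =>
    ((measure_mono inter_subset_left).trans_lt h.base_lt_top).ne
  rw [← ENNReal.tendsto_toReal_iff hfin ENNReal.zero_ne_top, ENNReal.toReal_zero]
  change Tendsto (fun k : ℕ => μ.real (B 0 ∩ T^[k] '' B 0)) atTop (𝓝 0)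
  refine tendsto_order.2 ⟨fun a ha => Eventually.of_forall fun k => ha.trans_le
    measureReal_nonneg, fun a ha => ?_⟩
  obtain ⟨m, hm⟩ := eventually_atTop.1 (eventually_ceil_sqrt_le (half_pos ha))
  filter_upwards [eventually_gt_atTop (scale m), eventually_ge_atTop m] with k hk hmk
  have hkn : 2 * k ≤ scale (2 * k) := (lt_scale _).le
  calc μ.real (B 0 ∩ T^[k] '' B 0) ≤ _ := measureReal_base_inter_iterate_le h hs h0 hkn
    _ ≤ a / 2 := by
      rw [div_le_iff₀ (by positivity)]
      exact diffCount_descendants_le hs hm (by exact_mod_cast hk) (by omega)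
    _ < a := half_lt_self ha

theorem isZeroType (h : IsCuttingStacking μ T cuts s B) (hs : HasPrescribedHeights s)
    (h0 : μ (B 0) = 1) : IsZeroType μ T := by
  intro A hA hAfin
  have hT := h.isRankOneAlong.measurePreserving
  rw [ENNReal.tendsto_nhds_zero]
  intro ε hε
  have hε3 : 0 < ε / 3 := ENNReal.div_pos hε.ne' (by norm_num)
  obtain ⟨n, hn⟩ := h.isRankOneAlong.approx A hA hAfin (ε / 3) hε3
  obtain ⟨F, -, hF⟩ := hn n le_rfl
  set U := ⋃ i ∈ F, T^[i] '' B n with hU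
  have hUk : ∀ᶠ k in atTop, μ (U ∩ T^[k] '' U) ≤ ε / 3 := by
    have hlim : Tendsto (fun k : ℕ => ∑ i ∈ F, ∑ j ∈ F, μ (B 0 ∩ T^[k + j - i] '' B 0))
        atTop (𝓝 0) := by
      have : (0 : ℝ≥0∞) = ∑ i ∈ F, ∑ j ∈ F, 0 := by simp
      rw [this]
      refine tendsto_finsetSum _ fun i _ => tendsto_finsetSum _ fun j _ => ?_
      refine (tendsto_base_inter h hs h0).comp (tendsto_atTop_mono (fun k => ?_)
        (tendsto_sub_atTop_nat i))
      omega
    -- Taking `k` beyond all of `F` keeps the subtraction in `k + j - i` from truncating.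
    filter_upwards [(ENNReal.tendsto_nhds_zero.1 hlim) _ hε3,
      eventually_ge_atTop (F.sup id)] with k hk hFk
    refine le_trans ?_ hk
    have hsub : U ∩ T^[k] '' U ⊆
        ⋃ i ∈ F, ⋃ j ∈ F, T^[i] '' (B 0 ∩ T^[k + j - i] '' B 0) := by
      rintro x ⟨hx, hx'⟩
      obtain ⟨i, hi, hxi⟩ := mem_iUnion₂.1 hx
      rw [hU, image_iUnion₂] at hx'
      obtain ⟨j, hj, hxj⟩ := mem_iUnion₂.1 hx'
      refine mem_iUnion₂.2 ⟨i, hi, mem_iUnion₂.2 ⟨j, hj, ?_⟩⟩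
      have hik : i ≤ k := (Finset.le_sup (f := id) hi).trans hFk
      rw [image_inter (iterate_injective T i), ← image_iterate_add,
        show i + (k + j - i) = k + j by omega]
      rw [← image_iterate_add] at hxj
      exact ⟨image_mono (h.base_subset n) hxi, image_mono (h.base_subset n) hxj⟩
    refine (measure_mono hsub).trans ((measure_biUnion_finset_le _ _).trans
      (Finset.sum_le_sum fun i _ => (measure_biUnion_finset_le _ _).trans
        (Finset.sum_le_sum fun j _ => ?_)))
    rw [measure_iterate_image hT]
  filter_upwards [hUk] with k hk
  have hsub : A ∩ T^[k] '' A ⊆ (U ∩ T^[k] '' U) ∪ ((A ∆ U) ∪ T^[k] '' (A ∆ U)) := by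
    rintro x ⟨hx, y, hy, rfl⟩
    by_cases h1 : T^[k] y ∈ U
    · by_cases h2 : y ∈ U
      · exact Or.inl ⟨h1, mem_image_of_mem _ h2⟩
      · exact Or.inr (Or.inr (mem_image_of_mem _ (Or.inl ⟨hy, h2⟩)))
    · exact Or.inr (Or.inl (Or.inl ⟨hx, h1⟩))
  calc μ (A ∩ T^[k] '' A) ≤ μ ((U ∩ T^[k] '' U) ∪ ((A ∆ U) ∪ T^[k] '' (A ∆ U))) :=
        measure_mono hsub
    _ ≤ μ (U ∩ T^[k] '' U) + (μ (A ∆ U) + μ (T^[k] '' (A ∆ U))) :=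
        (measure_union_le _ _).trans (add_le_add_right (measure_union_le _ _) _)
    _ ≤ ε / 3 + (ε / 3 + ε / 3) := by
        rw [measure_iterate_image hT]
        gcongr
    _ = ε := by rw [← add_assoc, ENNReal.add_thirds]

/-! ### Multiple recurrence -/

/-- Pulled back to `J`, the `k + 1` traces of `A` have null intersection, so their complements cover
`J` up to a null set and have total measure at least `μ J`. -/
theorem measureReal_sum_le_of_not_recurrent (hT : MeasurePreserving T μ μ) {A J : Set X}
    (hA : MeasurableSet A) (hJ : MeasurableSet J) (hJfin : μ J ≠ ∞) {k n : ℕ}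
    (hnull : μ (⋂ i ∈ Finset.range (k + 1), T^[i * n] '' A) = 0) :
    ∑ j ∈ Finset.range (k + 1), μ.real (A ∩ T^[j * n] '' J) ≤ k * μ.real J := by
  set E : ℕ → Set X := fun j => T^[j * n] ⁻¹' A ∩ J with hE
  have hTm : ∀ j, Measurable T^[j] := fun j => T.measurable.iterate j
  have hEm : ∀ j, MeasurableSet (E j) := fun j => (hTm _ hA).inter hJ
  have hEJ : ∀ j, μ.real (A ∩ T^[j * n] '' J) = μ.real (E j) := fun j => by
    rw [← measureReal_iterate_image hT (j * n) (E j), hE]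
    simp only [inter_comm _ J, image_inter_preimage]
    rw [inter_comm]
  have hinter : μ (⋂ j ∈ Finset.range (k + 1), E j) = 0 := by
    -- Shifting by `k * n` turns the preimage under `T^(jn)` into the image under `T^((k-j)n)`.
    rw [← measure_iterate_image hT (k * n)]
    refine measure_mono_null ?_ hnull
    rintro _ ⟨x, hx, rfl⟩
    simp only [mem_iInter, Finset.mem_range] at hx ⊢
    intro i hi
    refine ⟨T^[(k - i) * n] x, (hx (k - i) (by omega)).1, ?_⟩
    rw [← Function.iterate_add_apply, ← add_mul, Nat.add_sub_cancel' (by omega)]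
  have hcover : μ.real J ≤ ∑ j ∈ Finset.range (k + 1), μ.real (J \ E j) := by
    have hsub : J ⊆ (⋂ j ∈ Finset.range (k + 1), E j) ∪
        ⋃ j ∈ Finset.range (k + 1), J \ E j := by
      intro x hx
      by_cases hall : ∀ j ∈ Finset.range (k + 1), x ∈ E j
      · exact Or.inl (mem_iInter₂.2 hall)
      · push Not at hall
        obtain ⟨j, hj, hxj⟩ := hall
        exact Or.inr (mem_iUnion₂.2 ⟨j, hj, hx, hxj⟩)
    have hfin : μ (⋃ j ∈ Finset.range (k + 1), J \ E j) ≠ ∞ :=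
      ((measure_mono (iUnion₂_subset fun j _ => sdiff_subset)).trans_lt hJfin.lt_top).ne
    calc μ.real J ≤ μ.real (_ ∪ _) := measureReal_mono hsub
          ((measure_union_lt_top (by rw [hinter]; exact ENNReal.zero_lt_top) hfin.lt_top).ne)
      _ ≤ _ := measureReal_union_le _ _
      _ = μ.real (⋃ j ∈ Finset.range (k + 1), J \ E j) := by
        rw [measureReal_def, hinter, ENNReal.toReal_zero, zero_add]
      _ ≤ _ := measureReal_biUnion_finset_le _ _
  have hdiff : ∀ j, μ.real (J \ E j) = μ.real J - μ.real (E j) := fun j =>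
    measureReal_sdiff inter_subset_right (hEm j) hJfin
  simp only [hdiff, Finset.sum_sub_distrib, Finset.sum_const, Finset.card_range,
    nsmul_eq_mul] at hcover
  simp only [hEJ]
  push_cast at hcover
  linarith

/-- Here `d` counts the further cuttings taken into account. Each one settles the `k + 1` sublevels
in progression and multiplies the excess over `k/(k+1)` by at most `(m+1)/(m+2)`; the product
telescopes to `(m+1)/(m+d+1)`. For `d = 0` the bound is trivial. -/
theorem measureReal_inter_level_le (h : IsCuttingStacking μ T cuts s B)
    (hs : HasPrescribedHeights s) {A : Set X} (hA : MeasurableSet A) {k : ℕ}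
    (hnull : ∀ n, 1 ≤ n → μ (⋂ i ∈ Finset.range (k + 1), T^[i * n] '' A) = 0) (d : ℕ) {m : ℕ}
    (hm : k ^ 2 ≤ m) (i : ℕ) :
    μ.real (A ∩ T^[i] '' B m) ≤
      ((k : ℝ) / (k + 1) + (m + 1) / (m + d + 1)) * μ.real (B m) := by
  have hT := h.isRankOneAlong.measurePreserving
  induction d generalizing m i with
  | zero =>
    calc μ.real (A ∩ T^[i] '' B m) ≤ μ.real (T^[i] '' B m) :=
          measureReal_mono inter_subset_right (by
            rw [measure_iterate_image hT]; exact h.base_ne_top m)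
      _ = 1 * μ.real (B m) := by rw [measureReal_iterate_image hT, one_mul]
      _ ≤ _ := by
        gcongr
        rw [Nat.cast_zero, add_zero, div_self (by positivity)]
        have : (0 : ℝ) ≤ k / (k + 1) := by positivity
        linarith
  | succ d ih =>
    set w := μ.real (B (m + 1)) with hw
    have hw0 : 0 ≤ w := measureReal_nonneg
    have hkc : k ≤ ⌈Real.sqrt m⌉₊ := by
      have : (k : ℝ) ≤ Real.sqrt m := Real.le_sqrt_of_sq_le (by exact_mod_cast hm)
      exact_mod_cast this.trans (Nat.le_ceil _)
    set S : Finset ℕ := (Finset.range (k + 1)).image (· * scale m) with hS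
    have hSH : S ⊆ heightFinset s m := by
      intro x hx
      obtain ⟨j, hj, rfl⟩ := Finset.mem_image.1 hx
      rw [Finset.mem_range] at hj
      exact (mem_heightFinset_iff hs).2 (Or.inl ⟨j, by omega, rfl⟩)
    have hinj : Function.Injective (· * scale m) := fun x y hxy =>
      Nat.eq_of_mul_eq_mul_right (scale_pos m) hxy
    have hScard : S.card = k + 1 := by
      rw [hS, Finset.card_image_of_injective _ hinj, Finset.card_range]
    have hsplit : μ.real (A ∩ T^[i] '' B m) =
        ∑ x ∈ heightFinset s m \ S, μ.real (A ∩ T^[i + x] '' B (m + 1)) +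
          ∑ x ∈ S, μ.real (A ∩ T^[i + x] '' B (m + 1)) := by
      rw [Finset.sum_sdiff hSH, h.measureReal_base_inter m hA i, heightFinset,
        Finset.sum_image fun x _ y _ hxy => (subcolumnHeight_strictMono cuts_pos m).injective hxy]
    have h1 : ∑ x ∈ S, μ.real (A ∩ T^[i + x] '' B (m + 1)) ≤ k * w := by
      rw [hS, Finset.sum_image fun x _ y _ hxy => hinj hxy]
      have := measureReal_sum_le_of_not_recurrent hT hA
        (measurableSet_iterate_image T i (h.measurableSet_base (m + 1)))
        (by rw [measure_iterate_image hT]; exact h.base_ne_top _) (hnull _ (scale_pos m))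
      rw [measureReal_iterate_image hT] at this
      simpa only [← image_iterate_add, add_comm] using this
    have h2 : ∑ x ∈ heightFinset s m \ S, μ.real (A ∩ T^[i + x] '' B (m + 1)) ≤
        (m + 1 - k) * (((k : ℝ) / (k + 1) + (m + 2) / (m + d + 2)) * w) := by
      have hcard : ((heightFinset s m \ S).card : ℝ) = m + 1 - k := by
        rw [Finset.cast_card_sdiff hSH, hScard, card_heightFinset]
        push_cast
        ring
      rw [← hcard, ← nsmul_eq_mul]
      refine Finset.sum_le_card_nsmul _ _ _ fun x _ => ?_
      have := ih (m := m + 1) (by omega) (i + x)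
      push_cast at this
      rwa [show (m : ℝ) + 1 + 1 = m + 2 by ring, show (m : ℝ) + 1 + d + 1 = m + d + 2 by ring]
        at this
    have hB : μ.real (B m) = (m + 2) * w := by
      rw [h.measureReal_base_eq m, cuts]; push_cast; rfl
    rw [hsplit, hB]
    have hdm : (0 : ℝ) < m + d + 2 := by positivity
    -- The main terms agree because `k = (k + 1) * (k / (k + 1))`.
    have key : (m + 1 - k) * (((k : ℝ) / (k + 1) + (m + 2) / (m + d + 2)) * w) + k * w =
        (k / (k + 1) + (m + 1 - k) / (m + d + 2)) * ((m + 2) * w) := by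
      field_simp
      ring
    calc _ ≤ (m + 1 - k) * (((k : ℝ) / (k + 1) + (m + 2) / (m + d + 2)) * w) + k * w :=
          add_le_add h2 h1
      _ = _ := key
      _ ≤ (k / (k + 1) + (m + 1) / (m + d + 2)) * ((m + 2) * w) := by
        gcongr
        linarith [(Nat.cast_nonneg k : (0 : ℝ) ≤ k)]
      _ = _ := by
        push_cast
        congr 3
        ring

theorem isRecurrent_of_finite (h : IsCuttingStacking μ T cuts s B) (hs : HasPrescribedHeights s)
    (k : ℕ) {A : Set X} (hA : MeasurableSet A) (hApos : 0 < μ A)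
    (hAfin : μ A < ∞) :
    ∃ n : ℕ, 1 ≤ n ∧ 0 < μ (⋂ i ∈ Finset.range (k + 1), T^[i * n] '' A) := by
  by_contra! hcon
  have hT := h.isRankOneAlong.measurePreserving
  have hlevel : ∀ m, k ^ 2 ≤ m → ∀ i,
      μ.real (A ∩ T^[i] '' B m) ≤ (k : ℝ) / (k + 1) * μ.real (B m) := by
    intro m hm i
    have hlim : Tendsto (fun d : ℕ => ((k : ℝ) / (k + 1) + (m + 1) / (m + d + 1)) * μ.real (B m))
        atTop (𝓝 (((k : ℝ) / (k + 1) + 0) * μ.real (B m))) := by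
      refine (tendsto_const_nhds.add (Tendsto.div_atTop tendsto_const_nhds ?_)).mul_const _
      exact tendsto_atTop_add_const_right _ _
        (tendsto_atTop_add_const_left _ _ tendsto_natCast_atTop_atTop)
    rw [add_zero] at hlim
    exact ge_of_tendsto' hlim fun d => measureReal_inter_level_le h hs hA
      (fun n hn => le_antisymm (hcon n hn) bot_le) d hm i
  have hApos' : 0 < μ.real A := ENNReal.toReal_pos hApos.ne' hAfin.ne
  set θ : ℝ := (k : ℝ) / (k + 1) with hθ
  have hθ0 : 0 ≤ θ := by positivity
  have hθ1 : θ < 1 := by rw [hθ, div_lt_one (by positivity)]; linarith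
  set ε : ℝ := (1 - θ) * μ.real A / 2 with hε
  have hε0 : 0 < ε := by have := sub_pos.2 hθ1; positivity
  obtain ⟨N, hN⟩ := h.isRankOneAlong.approx A hA hAfin (ENNReal.ofReal ε)
    (ENNReal.ofReal_pos.2 hε0)
  obtain ⟨F, hFh, hF⟩ := hN (max N (k ^ 2)) (le_max_left _ _)
  set m := max N (k ^ 2) with hm
  set U := ⋃ i ∈ F, T^[i] '' B m with hU
  have hUm : ∀ i, MeasurableSet (T^[i] '' B m) := fun i =>
    measurableSet_iterate_image T i (h.measurableSet_base m)
  have hUfin : μ U ≠ ∞ := by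
    refine (measure_biUnion_lt_top F.finite_toSet fun i _ => ?_).ne
    rw [measure_iterate_image hT]
    exact (h.base_ne_top m).lt_top
  have hdisj : (F : Set ℕ).PairwiseDisjoint fun i => T^[i] '' B m := fun i hi j hj hij =>
    (h.isRankOneAlong.isColumn m).2 i (Finset.mem_range.1 (hFh hi)) j
      (Finset.mem_range.1 (hFh hj)) hij
  have hUmeas : μ.real U = ∑ i ∈ F, μ.real (B m) := by
    rw [hU, measureReal_biUnion_finset hdisj (fun i _ => hUm i) fun i _ => by
      rw [measure_iterate_image hT]; exact h.base_ne_top m]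
    simp only [measureReal_iterate_image hT]
  have hAU : μ.real (A ∩ U) ≤ θ * μ.real U := by
    rw [hUmeas, Finset.mul_sum, hU, inter_iUnion₂]
    exact (measureReal_biUnion_finset_le _ _).trans
      (Finset.sum_le_sum fun i _ => hlevel m (le_max_right _ _) i)
  have hFreal : μ.real (A ∆ U) < ε :=
    (ENNReal.lt_ofReal_iff_toReal_lt hF.ne_top).1 hF
  have h1 : μ.real (A \ U) ≤ μ.real (A ∆ U) := measureReal_mono subset_union_left hF.ne_top
  have h2 : μ.real (U \ A) ≤ μ.real (A ∆ U) := measureReal_mono subset_union_right hF.ne_top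
  have hUmeas' : MeasurableSet U := F.measurableSet_biUnion fun i _ => hUm i
  have h3 := measureReal_inter_add_sdiff (μ := μ) (s := A) hUmeas' hAfin.ne
  have h4 := measureReal_inter_add_sdiff (μ := μ) (s := U) hA hUfin
  rw [inter_comm] at h4
  nlinarith

theorem isMultiplyRecurrent [SigmaFinite μ] (h : IsCuttingStacking μ T cuts s B)
    (hs : HasPrescribedHeights s) : IsMultiplyRecurrent μ T := by
  intro k A hA hApos
  obtain ⟨A', hA'A, hA', hpos, hfin⟩ :
      ∃ A' ⊆ A, MeasurableSet A' ∧ 0 < μ A' ∧ μ A' < ∞ := by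
    obtain ⟨n, hn⟩ : ∃ n, 0 < μ (A ∩ spanningSets μ n) := by
      by_contra! hcon
      refine hApos.ne' ?_
      rw [← inter_univ A, ← iUnion_spanningSets μ, inter_iUnion]
      exact measure_iUnion_null fun n => le_antisymm (hcon n) bot_le
    exact ⟨_, inter_subset_left, hA.inter (measurableSet_spanningSets μ n), hn,
      (measure_mono inter_subset_right).trans_lt (measure_spanningSets_lt_top μ n)⟩
  obtain ⟨n, hn, hpos⟩ := isRecurrent_of_finite h hs k hA' hpos hfin
  exact ⟨n, hn, hpos.trans_le (measure_mono (iInter₂_mono fun i _ => image_mono hA'A))⟩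

end Levels

/-! ### Spacers realizing the prescribed heights -/

section Spacers

/-- The height of the `k`-th subcolumn of the `n`-th column, in units of `scale n`. -/
noncomputable def offset (n k : ℕ) : ℕ := if k ≤ ⌈Real.sqrt n⌉₊ then k else 5 ^ (k - 1)

/-- Spacer numbers that realize the prescribed height sets. -/
noncomputable def spacers (n k : ℕ) : ℕ := (offset n (k + 1) - offset n k - 1) * scale n

theorem offset_zero (n : ℕ) : offset n 0 = 0 := by simp [offset]

theorem offset_one (n : ℕ) : offset n 1 = 1 := by
  unfold offset
  split_ifs <;> simp

theorem offset_of_lt {n k : ℕ} (h : ⌈Real.sqrt n⌉₊ < k) : offset n k = 5 ^ (k - 1) :=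
  if_neg h.not_ge

/-- The index `n + 2` is past the last subcolumn: this value makes the last spacers fill `C (n+1)`
up to height `scale (n + 1)`. -/
theorem offset_add_two (n : ℕ) : offset n (n + 2) = 5 ^ (n + 1) :=
  offset_of_lt (by have := ceil_sqrt_le n; omega)

theorem offset_lt_succ (n k : ℕ) : offset n k < offset n (k + 1) := by
  unfold offset
  split_ifs with h1 h2 h2
  · omega
  · exact Nat.lt_pow_self (by norm_num)
  · omega
  · exact Nat.pow_lt_pow_right (by norm_num) (by omega)

theorem offset_strictMono (n : ℕ) : StrictMono (offset n) :=
  strictMono_nat_of_lt_succ (offset_lt_succ n)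

theorem offset_succ_le {n k : ℕ} (hk : k < n + 2) : offset n k + 1 ≤ 5 ^ (n + 1) := by
  rw [← offset_add_two]
  exact offset_strictMono n hk

theorem offset_le {n k : ℕ} (hk : k < n + 2) : offset n k ≤ 5 ^ n := by
  have h1 : offset n (n + 1) = 5 ^ n := offset_of_lt (by have := ceil_sqrt_le n; omega)
  rw [← h1]
  exact (offset_strictMono n).monotone (by omega)

theorem subcolumnHeight_spacers_of_height {n : ℕ} (h : height cuts spacers n = scale n) (k : ℕ) :
    subcolumnHeight cuts spacers n k = offset n k * scale n := by
  induction k with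
  | zero => simp [subcolumnHeight, offset_zero]
  | succ k ih =>
    rw [subcolumnHeight, Finset.sum_range_succ, h]
    rw [subcolumnHeight, h] at ih
    rw [ih, spacers]
    obtain ⟨d, hd⟩ := Nat.exists_eq_add_of_lt (offset_lt_succ n k)
    rw [hd, show offset n k + d + 1 - offset n k - 1 = d by omega]
    ring

theorem height_spacers (n : ℕ) : height cuts spacers n = scale n := by
  induction n with
  | zero => simp [height, scale]
  | succ n ih =>
    rw [← subcolumnHeight_cuts, subcolumnHeight_spacers_of_height ih, cuts, offset_add_two,
      scale_succ]

theorem subcolumnHeight_spacers (n k : ℕ) :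
    subcolumnHeight cuts spacers n k = offset n k * scale n :=
  subcolumnHeight_spacers_of_height (height_spacers n) k

theorem hasPrescribedHeights_spacers : HasPrescribedHeights spacers := by
  refine ⟨fun n => by simp [spacers, offset_zero, offset_one], fun n => ?_⟩
  ext m
  rw [mem_heightSet_iff (cuts_pos n), mem_prescribedHeights_iff]
  simp only [subcolumnHeight_spacers, cuts]
  have hc := ceil_sqrt_le n
  constructor
  · rintro ⟨k, hk, rfl⟩
    by_cases h : k ≤ ⌈Real.sqrt n⌉₊
    · exact Or.inl ⟨k, h, by rw [offset, if_pos h]⟩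
    · exact Or.inr ⟨k - 1, by omega, by omega, by rw [offset, if_neg h]⟩
  · rintro (⟨j, hj, rfl⟩ | ⟨i, hi, hin, rfl⟩)
    · exact ⟨j, by omega, by rw [offset, if_pos hj]⟩
    · exact ⟨i + 1, by omega, by rw [offset_of_lt (by omega), Nat.add_sub_cancel]⟩

/-- With levels of length `1/(n+1)!`, the column `C n` fills at least `(0, n+1]`, so the columns
exhaust the half-line. -/
theorem factorial_le_scale (n : ℕ) : (n + 1) * (n + 1).factorial ≤ scale n := by
  induction n with
  | zero => simp [scale]
  | succ n ih =>
    have h5 : 4 * n + 5 ≤ 5 ^ (n + 1) := by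
      clear ih
      induction n with
      | zero => norm_num
      | succ n ih => rw [pow_succ]; omega
    rw [scale_succ, Nat.factorial_succ (n + 1)]
    calc (n + 1 + 1) * ((n + 1 + 1) * (n + 1).factorial)
        = ((n + 1 + 1) * (n + 1 + 1)) * (n + 1).factorial := by ring
      _ ≤ ((4 * n + 5) * (n + 1)) * (n + 1).factorial := Nat.mul_le_mul_right _ (by nlinarith)
      _ = (4 * n + 5) * ((n + 1) * (n + 1).factorial) := by ring
      _ ≤ _ := Nat.mul_le_mul h5 ih

end Spacers

/-! ### The order of the levels -/

section Ordering

/-- Used to place the spacers: once the cells of the old column have their heights, the new cells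
may take the remaining heights in any order. -/
theorem exists_perm_extend {m : ℕ} {s : Finset ℕ} (hs : ∀ p ∈ s, p < m) {f : ℕ → ℕ}
    (hf : ∀ p ∈ s, f p < m) (hinj : Set.InjOn f s) :
    ∃ σ : Equiv.Perm ℕ, (∀ p, σ p < m ↔ p < m) ∧ ∀ p ∈ s, σ p = f p := by
  classical
  have : Fintype {p // p < m} := Fintype.subtype (Finset.range m) (by simp)
  obtain ⟨g, hg⟩ := Finset.exists_equiv_extend_of_card_eq (α := {p // p < m})
    (β := ℕ) (t := Finset.range m)
    (by rw [Fintype.card_of_subtype (Finset.range m) (by simp)]) (s := Finset.univ.filter fun p => p.1 ∈ s)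
    (f := fun p => f p) (by
      intro q hq
      simp only [Finset.mem_image, Finset.mem_filter, Finset.mem_univ, true_and] at hq
      obtain ⟨p, hp, rfl⟩ := hq
      exact Finset.mem_range.2 (hf _ hp))
    (by
      intro p hp q hq hpq
      simp at hp hq
      exact Subtype.ext (hinj hp hq hpq))
  let e : Equiv.Perm {p // p < m} :=
    g.trans (Equiv.subtypeEquivRight fun p => Finset.mem_range)
  refine ⟨Equiv.Perm.ofSubtype e, fun p => ?_, fun p hp => ?_⟩
  · by_cases hp : p < m
    · rw [Equiv.Perm.ofSubtype_apply_of_mem e hp]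
      exact ⟨fun _ => hp, fun _ => (e ⟨p, hp⟩).2⟩
    · rw [Equiv.Perm.ofSubtype_apply_of_not_mem e hp]
  · rw [Equiv.Perm.ofSubtype_apply_of_mem e (hs p hp)]
    exact hg ⟨p, hs p hp⟩ (by simpa using hp)

theorem exists_ordering : ∃ P : ℕ → Equiv.Perm ℕ, (∀ n p, P n p < scale n ↔ p < scale n) ∧
    ∀ n p, p < (n + 2) * scale n →
      P (n + 1) p = offset n (p % (n + 2)) * scale n + P n (p / (n + 2)) := by
  have step : ∀ (n : ℕ) (σ : Equiv.Perm ℕ), (∀ p, σ p < scale n ↔ p < scale n) →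
      ∃ τ : Equiv.Perm ℕ, (∀ p, τ p < scale (n + 1) ↔ p < scale (n + 1)) ∧
        ∀ p ∈ Finset.range ((n + 2) * scale n),
          τ p = offset n (p % (n + 2)) * scale n + σ (p / (n + 2)) := by
    intro n σ hσ
    have hdiv : ∀ p < (n + 2) * scale n, σ (p / (n + 2)) < scale n := fun p hp =>
      (hσ _).2 (Nat.div_lt_of_lt_mul hp)
    refine exists_perm_extend (fun p hp => ?_) (fun p hp => ?_) ?_
    · rw [Finset.mem_range] at hp
      refine hp.trans_le ?_
      rw [scale_succ]
      exact Nat.mul_le_mul_right _ (Nat.lt_pow_self (by norm_num))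
    · rw [Finset.mem_range] at hp
      have h1 := hdiv p hp
      have h2 := Nat.mul_le_mul_right (scale n)
        (offset_succ_le (n := n) (Nat.mod_lt p (by omega : 0 < n + 2)))
      rw [scale_succ]
      linarith
    · intro p hp q hq hpq
      simp only [Finset.coe_range, mem_Iio] at hp hq
      have hp' := hdiv p hp
      have hq' := hdiv q hq
      simp only at hpq
      have h1 : offset n (p % (n + 2)) = offset n (q % (n + 2)) := by
        have := congrArg (· / scale n) hpq
        simpa [Nat.mul_add_div (scale_pos n), mul_comm _ (scale n), Nat.div_eq_of_lt hp',
          Nat.div_eq_of_lt hq'] using this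
      have h2 : p / (n + 2) = q / (n + 2) := σ.injective (by rw [h1] at hpq; omega)
      rw [← Nat.div_add_mod p (n + 2), ← Nat.div_add_mod q (n + 2), h2,
        (offset_strictMono n).injective h1]
  choose f hf using step
  let L : ∀ n, {σ : Equiv.Perm ℕ // ∀ p, σ p < scale n ↔ p < scale n} :=
    Nat.rec ⟨1, fun p => Iff.rfl⟩ fun n σ => ⟨f n σ.1 σ.2, (hf n σ.1 σ.2).1⟩
  exact ⟨fun n => (L n).1, fun n => (L n).2, fun n p hp =>
    (hf n (L n).1 (L n).2).2 p (Finset.mem_range.2 hp)⟩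

end Ordering

/-! ### Grids on the half-line -/

section Grid

/-- The index of the interval `(j / (n + 1)!, (j + 1) / (n + 1)!]` that contains `x`. -/
noncomputable def cell (n : ℕ) (x : Ioi (0 : ℝ)) : ℕ := ⌈(x : ℝ) * (n + 1).factorial⌉₊ - 1

theorem cell_eq_iff {n : ℕ} {x : Ioi (0 : ℝ)} {j : ℕ} :
    cell n x = j ↔ (j : ℝ) < x * (n + 1).factorial ∧ (x : ℝ) * (n + 1).factorial ≤ j + 1 := by
  have hx : 0 < (x : ℝ) * (n + 1).factorial := mul_pos x.2 (by positivity)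
  have h1 : 0 < ⌈(x : ℝ) * (n + 1).factorial⌉₊ := Nat.ceil_pos.2 hx
  have h2 : cell n x = j ↔ ⌈(x : ℝ) * (n + 1).factorial⌉₊ = j + 1 := by unfold cell; omega
  rw [h2, Nat.ceil_eq_iff (by omega)]
  simp

theorem cell_lt (n : ℕ) (x : Ioi (0 : ℝ)) : (cell n x : ℝ) < x * (n + 1).factorial :=
  (cell_eq_iff.1 rfl).1

theorem le_cell (n : ℕ) (x : Ioi (0 : ℝ)) : (x : ℝ) * (n + 1).factorial ≤ cell n x + 1 :=
  (cell_eq_iff.1 rfl).2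

theorem factorial_add_two (n : ℕ) :
    ((n + 1 + 1).factorial : ℝ) = (n + 2) * (n + 1).factorial := by
  rw [Nat.factorial_succ]; push_cast; ring

theorem cell_succ_div (n : ℕ) (x : Ioi (0 : ℝ)) : cell (n + 1) x / (n + 2) = cell n x := by
  symm
  rw [cell_eq_iff]
  have h1 := cell_lt (n + 1) x
  have h2 := le_cell (n + 1) x
  rw [factorial_add_two] at h1 h2
  have h3 : ((cell (n + 1) x / (n + 2) : ℕ) : ℝ) * (n + 2) ≤ cell (n + 1) x := by
    exact_mod_cast Nat.div_mul_le_self _ _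
  have h4 : (cell (n + 1) x : ℝ) + 1 ≤ ((cell (n + 1) x / (n + 2) : ℕ) + 1) * (n + 2) := by
    rw [mul_comm]
    exact_mod_cast Nat.lt_mul_div_succ _ (by omega : 0 < n + 2)
  have hn : (0 : ℝ) < n + 2 := by positivity
  constructor
  · refine lt_of_mul_lt_mul_right ?_ hn.le
    linarith
  · refine le_of_mul_le_mul_right ?_ hn
    linarith

theorem measurable_cell (n : ℕ) : Measurable (cell n) := by
  unfold cell
  exact (measurable_from_top (f := fun k : ℕ => k - 1)).comp
    (Nat.measurable_ceil.comp (measurable_subtype_coe.mul_const _))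

/-- The translate of `x` into the cell with index `j`. -/
noncomputable def toCell (n j : ℕ) (x : Ioi (0 : ℝ)) : Ioi (0 : ℝ) :=
  ⟨x + ((j : ℝ) - cell n x) / (n + 1).factorial, by
    have h := cell_lt n x
    have hN : (0 : ℝ) < (n + 1).factorial := by positivity
    rw [← div_lt_iff₀ hN] at h
    have hj : (0 : ℝ) ≤ j / (n + 1).factorial := by positivity
    rw [mem_Ioi, sub_div]
    linarith⟩

theorem coe_toCell_mul (n j : ℕ) (x : Ioi (0 : ℝ)) :
    (toCell n j x : ℝ) * (n + 1).factorial = x * (n + 1).factorial + (j - cell n x) := by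
  have hN : ((n + 1).factorial : ℝ) ≠ 0 := by positivity
  simp only [toCell]
  field_simp

theorem cell_toCell (n j : ℕ) (x : Ioi (0 : ℝ)) : cell n (toCell n j x) = j := by
  rw [cell_eq_iff, coe_toCell_mul]
  have := cell_lt n x
  have := le_cell n x
  constructor <;> linarith

theorem toCell_cell (n : ℕ) (x : Ioi (0 : ℝ)) : toCell n (cell n x) x = x := by
  ext
  simp [toCell]

theorem toCell_toCell (n i j : ℕ) (x : Ioi (0 : ℝ)) :
    toCell n j (toCell n i x) = toCell n j x := by
  have hN : ((n + 1).factorial : ℝ) ≠ 0 := by positivity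
  ext
  apply mul_right_cancel₀ hN
  rw [coe_toCell_mul, coe_toCell_mul, coe_toCell_mul, cell_toCell]
  ring

/-- Translating a cell carries its subcells along in order. This makes the maps defined on
successive columns agree. -/
theorem toCell_succ (n j : ℕ) (x : Ioi (0 : ℝ)) :
    toCell (n + 1) ((n + 2) * j + cell (n + 1) x % (n + 2)) x = toCell n j x := by
  have hN : ((n + 1 + 1).factorial : ℝ) ≠ 0 := by positivity
  ext
  apply mul_right_cancel₀ hN
  have h1 : (cell (n + 1) x : ℝ) = (n + 2) * cell n x + (cell (n + 1) x % (n + 2) : ℕ) := by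
    rw [← cell_succ_div n x]
    exact_mod_cast (Nat.div_add_mod _ _).symm
  rw [coe_toCell_mul, factorial_add_two, mul_left_comm (toCell n j x : ℝ), coe_toCell_mul]
  conv_lhs => rw [h1]
  push_cast
  ring

theorem measurable_toCell (n : ℕ) (g : ℕ → ℕ) : Measurable fun x => toCell n (g (cell n x)) x := by
  refine Measurable.subtype_mk (measurable_subtype_coe.add ?_)
  exact (measurable_from_top (f := fun q : ℕ => ((g q : ℝ) - q) / (n + 1).factorial)).comp
    (measurable_cell n)

theorem eventually_cell_lt (x : Ioi (0 : ℝ)) : ∀ᶠ n in atTop, cell n x < scale n := by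
  filter_upwards [eventually_ge_atTop ⌈(x : ℝ)⌉₊] with n hn
  have h1 : (x : ℝ) ≤ n := (Nat.le_ceil _).trans (by exact_mod_cast hn)
  have h2 : ((n + 1 : ℕ) * (n + 1).factorial : ℝ) ≤ scale n := by
    exact_mod_cast factorial_le_scale n
  have h3 := cell_lt n x
  have hN : (0 : ℝ) < (n + 1).factorial := by positivity
  push_cast at h2
  exact_mod_cast (show (cell n x : ℝ) < scale n by nlinarith)

theorem eventually_cell_pos (x : Ioi (0 : ℝ)) : ∀ᶠ n in atTop, 0 < cell n x := by
  filter_upwards [eventually_gt_atTop ⌈1 / (x : ℝ)⌉₊] with n hn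
  have hx : (0 : ℝ) < x := x.2
  have h1 : 1 / (x : ℝ) < n := (Nat.le_ceil _).trans_lt (by exact_mod_cast hn)
  rw [div_lt_iff₀ hx] at h1
  have h2 : (n : ℝ) ≤ (n + 1).factorial := by
    exact_mod_cast (Nat.le_succ n).trans (Nat.self_le_factorial _)
  have h3 := le_cell n x
  exact_mod_cast (show (0 : ℝ) < cell n x by nlinarith)

end Grid

/-! ### Positions in the columns -/

section Position

variable {P : ℕ → Equiv.Perm ℕ}

/-- The height of the level of the `n`-th column that contains `x`. -/
noncomputable def position (P : ℕ → Equiv.Perm ℕ) (n : ℕ) (x : Ioi (0 : ℝ)) : ℕ := P n (cell n x)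

/-- The translate of `x` into the level of height `j` of the `n`-th column. -/
noncomputable def toLevel (P : ℕ → Equiv.Perm ℕ) (n j : ℕ) (x : Ioi (0 : ℝ)) : Ioi (0 : ℝ) :=
  toCell n ((P n).symm j) x

theorem position_toLevel (n j : ℕ) (x : Ioi (0 : ℝ)) : position P n (toLevel P n j x) = j := by
  simp [position, toLevel, cell_toCell]

theorem toLevel_position (n : ℕ) (x : Ioi (0 : ℝ)) : toLevel P n (position P n x) x = x := by
  simp [position, toLevel, toCell_cell]

theorem toLevel_toLevel (n i j : ℕ) (x : Ioi (0 : ℝ)) :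
    toLevel P n j (toLevel P n i x) = toLevel P n j x := toCell_toCell _ _ _ _

theorem measurable_toLevel (P : ℕ → Equiv.Perm ℕ) (n : ℕ) (g : ℕ → ℕ) :
    Measurable fun x => toLevel P n (g (position P n x)) x :=
  measurable_toCell n fun q => (P n).symm (g (P n q))

theorem measurable_position (P : ℕ → Equiv.Perm ℕ) (n : ℕ) : Measurable (position P n) :=
  (measurable_from_top (f := P n)).comp (measurable_cell n)

/-- `P` orders the cells of each grid compatibly with cutting and stacking: `P n p` is the height
of the `p`-th cell in the `n`-th column. -/
structure IsOrdering (P : ℕ → Equiv.Perm ℕ) : Prop where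
  lt_iff : ∀ n p, P n p < scale n ↔ p < scale n
  succ : ∀ n p, p < (n + 2) * scale n →
    P (n + 1) p = offset n (p % (n + 2)) * scale n + P n (p / (n + 2))

namespace IsOrdering

variable (hP : IsOrdering P)
include hP

theorem apply_zero (n : ℕ) : P n 0 = 0 := by
  induction n with
  | zero =>
    have := (hP.lt_iff 0 0).2 (scale_pos 0)
    simpa [scale] using this
  | succ n ih =>
    rw [hP.succ n 0 (Nat.mul_pos (by omega) (scale_pos n))]
    simp [ih, offset_zero]

theorem position_lt_iff (n : ℕ) (x : Ioi (0 : ℝ)) : position P n x < scale n ↔ cell n x < scale n :=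
  hP.lt_iff n _

theorem position_succ {n : ℕ} {x : Ioi (0 : ℝ)} (h : position P n x < scale n) :
    position P (n + 1) x =
      offset n (cell (n + 1) x % (n + 2)) * scale n + position P n x := by
  rw [hP.position_lt_iff, ← cell_succ_div] at h
  rw [position, hP.succ n _ (by rwa [Nat.div_lt_iff_lt_mul (by omega), mul_comm] at h),
    cell_succ_div, position]

theorem toLevel_succ {n j : ℕ} (hj : j < scale n) (x : Ioi (0 : ℝ)) :
    toLevel P (n + 1) (offset n (cell (n + 1) x % (n + 2)) * scale n + j) x =
      toLevel P n j x := by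
  set k := cell (n + 1) x % (n + 2) with hk
  have hkn : k < n + 2 := Nat.mod_lt _ (by omega)
  set p := (P n).symm j with hp
  have hpj : P n p = j := (P n).apply_symm_apply j
  have hps : p < scale n := (hP.lt_iff n p).1 (hpj ▸ hj)
  have hlt : (n + 2) * p + k < (n + 2) * scale n := by
    calc (n + 2) * p + k < (n + 2) * p + (n + 2) := by omega
      _ = (n + 2) * (p + 1) := by ring
      _ ≤ _ := Nat.mul_le_mul_left _ hps
  have h1 : P (n + 1) ((n + 2) * p + k) = offset n k * scale n + j := by
    rw [hP.succ n _ hlt, Nat.mul_add_mod, Nat.mod_eq_of_lt hkn, Nat.mul_add_div (by omega),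
      Nat.div_eq_of_lt hkn, add_zero, hpj]
  rw [toLevel, ← h1, Equiv.symm_apply_apply, hk, toCell_succ, toLevel]

/-- The last copy of `C n` ends at height at most `(5^n + 1) * scale n`, below the top of `C (n+1)`,
so a point of `C n` is never in the top level of `C (n+1)`. -/
theorem position_succ_add_one_lt {n : ℕ} {x : Ioi (0 : ℝ)} (h : position P n x < scale n) :
    position P (n + 1) x + 1 < scale (n + 1) := by
  have h1 := offset_le (n := n) (Nat.mod_lt (cell (n + 1) x) (by omega : 0 < n + 2))
  rw [hP.position_succ h, scale_succ, pow_succ]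
  have h2 := Nat.mul_le_mul_right (scale n) h1
  have h3 := Nat.mul_le_mul_right (scale n) (Nat.one_le_pow n 5 (by norm_num))
  have := scale_pos n
  rw [one_mul] at h3
  linarith

theorem eventually_position_lt (x : Ioi (0 : ℝ)) : ∀ᶠ n in atTop, position P n x < scale n := by
  simpa only [hP.position_lt_iff] using eventually_cell_lt x

theorem eventually_position_add_one_lt (x : Ioi (0 : ℝ)) :
    ∀ᶠ n in atTop, position P n x + 1 < scale n := by
  obtain ⟨N, hN⟩ := eventually_atTop.1 (hP.eventually_position_lt x)
  filter_upwards [eventually_gt_atTop N] with n hn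
  obtain ⟨m, rfl⟩ : ∃ m, n = m + 1 := ⟨n - 1, by omega⟩
  exact hP.position_succ_add_one_lt (hN m (by omega))

theorem eventually_position_pos (x : Ioi (0 : ℝ)) : ∀ᶠ n in atTop, 0 < position P n x := by
  filter_upwards [eventually_cell_pos x] with n hn
  rw [position, Nat.pos_iff_ne_zero, ← hP.apply_zero n]
  exact (P n).injective.ne hn.ne'

end IsOrdering

theorem exists_stable_limit {α β : Type*} {p : ℕ → α → Prop} {F : ℕ → α → β}
    (hex : ∀ x, ∃ n, p n x) (hstep : ∀ n x, p n x → p (n + 1) x ∧ F (n + 1) x = F n x) :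
    ∃ T : α → β, ∀ n x, p n x → T x = F n x := by
  classical
  refine ⟨fun x => F (Nat.find (hex x)) x, fun n x hn => ?_⟩
  have hle : Nat.find (hex x) ≤ n := Nat.find_min' _ hn
  have key : ∀ m, Nat.find (hex x) ≤ m → p m x ∧ F m x = F (Nat.find (hex x)) x := by
    intro m hm
    induction m, hm using Nat.le_induction with
    | base => exact ⟨Nat.find_spec (hex x), rfl⟩
    | succ m _ ih => exact ⟨(hstep m x ih.1).1, (hstep m x ih.1).2.trans ih.2⟩
  exact (key n hle).2.symm

/-- The transformation that moves each level of each column to the next one. -/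
theorem IsOrdering.exists_measurableEquiv (hP : IsOrdering P) :
    ∃ T : Ioi (0 : ℝ) ≃ᵐ Ioi (0 : ℝ),
      (∀ n x, position P n x + 1 < scale n → T x = toLevel P n (position P n x + 1) x) ∧
      ∀ n x, 0 < position P n x ∧ position P n x < scale n →
        T.symm x = toLevel P n (position P n x - 1) x := by
  obtain ⟨T, hT⟩ := exists_stable_limit
    (p := fun n x => position P n x + 1 < scale n)
    (F := fun n x => toLevel P n (position P n x + 1) x)
    (fun x => (hP.eventually_position_add_one_lt x).exists) (fun n x hn => by
      have h := hP.position_succ (x := x) (Nat.lt_of_succ_lt hn)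
      refine ⟨hP.position_succ_add_one_lt (Nat.lt_of_succ_lt hn), ?_⟩
      simp only [h, add_assoc]
      exact hP.toLevel_succ hn x)
  obtain ⟨S, hS⟩ := exists_stable_limit
    (p := fun n x => 0 < position P n x ∧ position P n x < scale n)
    (F := fun n x => toLevel P n (position P n x - 1) x)
    (fun x => ((hP.eventually_position_pos x).and (hP.eventually_position_lt x)).exists)
    (fun n x hn => by
      have h := hP.position_succ hn.2
      refine ⟨⟨by omega, (Nat.lt_succ_self _).trans (hP.position_succ_add_one_lt hn.2)⟩, ?_⟩
      simp only [h, Nat.add_sub_assoc hn.1]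
      exact hP.toLevel_succ (by omega) x)
  have hTm : Measurable T := by
    refine measurable_of_tendsto_metrizable
      (f := fun n x => toLevel P n (position P n x + 1) x)
      (fun n => measurable_toLevel P n (· + 1)) (tendsto_pi_nhds.2 fun x => ?_)
    refine tendsto_const_nhds.congr' ?_
    filter_upwards [hP.eventually_position_add_one_lt x] with n hn using hT n x hn
  have hSm : Measurable S := by
    refine measurable_of_tendsto_metrizable
      (f := fun n x => toLevel P n (position P n x - 1) x)
      (fun n => measurable_toLevel P n (· - 1)) (tendsto_pi_nhds.2 fun x => ?_)
    refine tendsto_const_nhds.congr' ?_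
    filter_upwards [hP.eventually_position_pos x, hP.eventually_position_lt x] with n h1 h2
      using hS n x ⟨h1, h2⟩
  refine ⟨⟨⟨T, S, fun x => ?_, fun x => ?_⟩, hTm, hSm⟩, hT, hS⟩
  · obtain ⟨n, hn⟩ := (hP.eventually_position_add_one_lt x).exists
    have h1 := hT n x hn
    have h2 : position P n (T x) = position P n x + 1 := by rw [h1, position_toLevel]
    rw [hS n (T x) (by omega), h2, Nat.add_sub_cancel, h1, toLevel_toLevel, toLevel_position]
  · obtain ⟨n, h0, hn⟩ :=
      ((hP.eventually_position_pos x).and (hP.eventually_position_lt x)).exists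
    have h1 := hS n x ⟨h0, hn⟩
    have h2 : position P n (S x) = position P n x - 1 := by rw [h1, position_toLevel]
    rw [hT n (S x) (by omega), h2, Nat.sub_add_cancel h0, h1, toLevel_toLevel, toLevel_position]

end Position

/-! ### Existence -/

section Existence

theorem comap_coe_apply (A : Set (Ioi (0 : ℝ))) :
    Measure.comap Subtype.val (volume : Measure ℝ) A = volume (Subtype.val '' A) :=
  (MeasurableEmbedding.subtype_coe measurableSet_Ioi).comap_apply _ _

/-- The half-line splits into countably many measurable pieces, on each of which `T` is a
translation. -/
theorem measurePreserving_of_countable_translations (T : Ioi (0 : ℝ) ≃ᵐ Ioi (0 : ℝ)) {D : Set ℝ}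
    (hD : D.Countable) (hT : ∀ x, (T x : ℝ) - x ∈ D) :
    MeasurePreserving T (Measure.comap Subtype.val (volume : Measure ℝ))
      (Measure.comap Subtype.val (volume : Measure ℝ)) := by
  set μ := Measure.comap (Subtype.val : Ioi (0 : ℝ) → ℝ) (volume : Measure ℝ) with hμ
  have := hD.to_subtype
  have key : ∀ A, MeasurableSet A → μ (T '' A) = μ A := by
    intro A hA
    let E : D → Set (Ioi (0 : ℝ)) := fun d => A ∩ {x | (T x : ℝ) - x = d}
    have hE : ∀ d, MeasurableSet (E d) := fun d => hA.inter
      (((measurable_subtype_coe.comp T.measurable).sub measurable_subtype_coe)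
        (measurableSet_singleton _))
    have hdisj : Pairwise (Function.onFun Disjoint E) := by
      intro d e hde
      rw [Function.onFun, Set.disjoint_left]
      rintro x ⟨-, hx⟩ ⟨-, hx'⟩
      exact hde (Subtype.ext (hx.symm.trans hx'))
    have hA' : A = ⋃ d, E d := by
      ext x
      simp only [mem_iUnion]
      exact ⟨fun hx => ⟨⟨_, hT x⟩, hx, rfl⟩, fun ⟨d, hx⟩ => hx.1⟩
    conv_lhs => rw [hA']
    conv_rhs => rw [hA']
    rw [image_iUnion, measure_iUnion hdisj hE, measure_iUnion
      (fun d e hde => (disjoint_image_iff T.injective).2 (hdisj hde))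
      fun d => T.measurableSet_image.2 (hE d)]
    refine tsum_congr fun d => ?_
    rw [hμ, comap_coe_apply, comap_coe_apply]
    have : (Subtype.val '' (T '' E d) : Set ℝ) = (fun y => (d : ℝ) + y) '' (Subtype.val '' E d) := by
      rw [image_image, image_image]
      refine image_congr fun x hx => ?_
      have := hx.2
      rw [mem_ofPred_eq] at this
      linarith
    rw [this, image_add_left, measure_preimage_add]
  refine ⟨T.measurable, Measure.ext fun A hA => ?_⟩
  rw [Measure.map_apply T.measurable hA, ← key _ (T.measurable hA), image_preimage_eq _ T.surjective]

variable {P : ℕ → Equiv.Perm ℕ}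

/-- The level of height `i` of the `n`-th column. -/
def level (P : ℕ → Equiv.Perm ℕ) (n i : ℕ) : Set (Ioi (0 : ℝ)) := {x | position P n x = i}

theorem measurableSet_level (P : ℕ → Equiv.Perm ℕ) (n i : ℕ) : MeasurableSet (level P n i) :=
  measurable_position P n (measurableSet_singleton i)

theorem IsOrdering.level_approx (hP : IsOrdering P) {A : Set (Ioi (0 : ℝ))}
    (hA : MeasurableSet A) (hAfin : Measure.comap Subtype.val (volume : Measure ℝ) A < ∞)
    {ε : ℝ≥0∞} (hε : 0 < ε) :
    ∃ N, ∀ n ≥ N, ∃ F : Finset ℕ, F ⊆ Finset.range (scale n) ∧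
      Measure.comap Subtype.val (volume : Measure ℝ) (A ∆ ⋃ i ∈ F, level P n i) < ε := by
  classical
  set μ := Measure.comap (Subtype.val : Ioi (0 : ℝ) → ℝ) (volume : Measure ℝ) with hμ
  have hε2 : ε / 2 ≠ 0 := (ENNReal.half_pos hε.ne').ne'
  obtain ⟨U, hU, hAU, hUfin, hUA⟩ : ∃ U : Set (Ioi (0 : ℝ)), IsOpen U ∧ A ⊆ U ∧ μ U < ∞ ∧
      μ (U \ A) < ε / 2 := by
    obtain ⟨V, hAV, hV, hVfin, hVA⟩ := MeasurableSet.exists_isOpen_sdiff_lt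
      (μ := (volume : Measure ℝ)) (measurableSet_Ioi.subtype_image hA)
      (by rw [← comap_coe_apply]; exact hAfin.ne) hε2
    refine ⟨Subtype.val ⁻¹' V, hV.preimage continuous_subtype_val, image_subset_iff.1 hAV, ?_, ?_⟩
    · rw [hμ, comap_coe_apply]
      exact (measure_mono (image_preimage_subset _ _)).trans_lt hVfin
    · rw [hμ, comap_coe_apply]
      refine (measure_mono ?_).trans_lt hVA
      rintro _ ⟨x, ⟨hxV, hxA⟩, rfl⟩
      refine ⟨hxV, ?_⟩
      rintro ⟨y, hy, hyx⟩
      exact hxA (Subtype.ext hyx ▸ hy)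
  let F : ℕ → Finset ℕ := fun n => (Finset.range (scale n)).filter fun i => level P n i ⊆ U
  let V : ℕ → Set (Ioi (0 : ℝ)) := fun n => ⋃ i ∈ F n, level P n i
  have hVU : ∀ n, V n ⊆ U := fun n => iUnion₂_subset fun i hi => (Finset.mem_filter.1 hi).2
  have hVm : ∀ n, MeasurableSet (V n) := fun n =>
    (F n).measurableSet_biUnion fun i _ => measurableSet_level P n i
  have hmem : ∀ x ∈ U, ∀ᶠ n in atTop, x ∈ V n := by
    intro x hx
    obtain ⟨δ, hδ, hball⟩ := Metric.isOpen_iff.1 hU x hx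
    filter_upwards [hP.eventually_position_lt x, eventually_gt_atTop ⌈1 / δ⌉₊] with n hn hnδ
    refine mem_iUnion₂.2 ⟨position P n x, ?_, rfl⟩
    refine Finset.mem_filter.2 ⟨Finset.mem_range.2 hn, fun y hy => hball ?_⟩
    have hc : cell n y = cell n x := (P n).injective hy
    have h1 : 1 / δ < n := (Nat.le_ceil _).trans_lt (by exact_mod_cast hnδ)
    rw [div_lt_iff₀ hδ] at h1
    have h2 : (n : ℝ) ≤ (n + 1).factorial := by
      exact_mod_cast (Nat.le_succ n).trans (Nat.self_le_factorial _)
    have hN : (0 : ℝ) < (n + 1).factorial := by positivity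
    have hx1 := cell_lt n x
    have hx2 := le_cell n x
    have hy1 := cell_lt n y
    have hy2 := le_cell n y
    rw [hc] at hy1 hy2
    rw [Metric.mem_ball, Subtype.dist_eq, Real.dist_eq, abs_lt]
    constructor
    · refine lt_of_mul_lt_mul_right ?_ hN.le
      nlinarith
    · refine lt_of_mul_lt_mul_right ?_ hN.le
      nlinarith
  -- Tail unions decrease to the empty set, so continuity from above applies without comparing the
  -- `V n` with each other.
  let W : ℕ → Set (Ioi (0 : ℝ)) := fun N => ⋃ n ≥ N, U \ V n
  have hlim : Tendsto (fun N => μ (W N)) atTop (𝓝 0) := by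
    have hanti : Antitone W := fun N M hNM =>
      biUnion_mono (fun n (hn : M ≤ n) => hNM.trans hn) fun _ _ => Subset.rfl
    have hempty : ⋂ N, W N = ∅ := by
      rw [eq_empty_iff_forall_notMem]
      intro x hx
      rw [mem_iInter] at hx
      obtain ⟨n, -, hxn⟩ := mem_iUnion₂.1 (hx 0)
      obtain ⟨N, hN⟩ := eventually_atTop.1 (hmem x hxn.1)
      obtain ⟨m, hm, hxm⟩ := mem_iUnion₂.1 (hx N)
      exact hxm.2 (hN m hm)
    have := tendsto_measure_iInter_atTop (μ := μ) (s := W)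
      (fun N => (MeasurableSet.iUnion fun n => MeasurableSet.iUnion fun _ =>
        hU.measurableSet.diff (hVm n)).nullMeasurableSet) hanti
      ⟨0, ((measure_mono (iUnion₂_subset fun n _ => sdiff_subset)).trans_lt hUfin).ne⟩
    rwa [hempty, measure_empty] at this
  obtain ⟨N, hN⟩ := ((tendsto_order.1 hlim).2 _ (pos_iff_ne_zero.2 hε2)).exists
  refine ⟨N, fun n hn => ⟨F n, Finset.filter_subset _ _, ?_⟩⟩
  have hsub : A ∆ V n ⊆ (U \ A) ∪ W N := by
    rintro x (⟨hx, hx'⟩ | ⟨hx, hx'⟩)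
    · exact Or.inr (mem_iUnion₂.2 ⟨n, hn, hAU hx, hx'⟩)
    · exact Or.inl ⟨hVU n hx, hx'⟩
  calc μ (A ∆ V n) ≤ μ (U \ A) + μ (W N) := (measure_mono hsub).trans (measure_union_le _ _)
    _ < ε / 2 + ε / 2 := ENNReal.add_lt_add hUA hN
    _ = ε := ENNReal.add_halves ε

theorem exists_isCuttingStacking :
    ∃ (T : Ioi (0 : ℝ) ≃ᵐ Ioi (0 : ℝ)) (s : ℕ → ℕ → ℕ) (B : ℕ → Set (Ioi (0 : ℝ))),
      HasPrescribedHeights s ∧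
      IsCuttingStacking (Measure.comap Subtype.val (volume : Measure ℝ)) T cuts s B ∧
      B 0 = {x : Ioi (0 : ℝ) | (x : ℝ) ≤ 1} := by
  obtain ⟨P, hP1, hP2⟩ := exists_ordering
  have hP : IsOrdering P := ⟨hP1, hP2⟩
  obtain ⟨T, hT, hS⟩ := hP.exists_measurableEquiv
  have hlevel : ∀ n i, i < scale n → T^[i] '' level P n 0 = level P n i := by
    intro n i hi
    induction i with
    | zero => simp
    | succ i ih =>
      rw [Function.iterate_succ', image_comp, ih (by omega)]
      ext y
      constructor
      · rintro ⟨x, hx : position P n x = i, rfl⟩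
        rw [level, mem_ofPred_eq, hT n x (by omega), position_toLevel, hx]
      · intro (hy : position P n y = i + 1)
        refine ⟨T.symm y, ?_, T.apply_symm_apply y⟩
        rw [level, mem_ofPred_eq, hS n y (by omega), position_toLevel, hy, Nat.add_sub_cancel]
  have hbase : level P 0 0 = {x : Ioi (0 : ℝ) | (x : ℝ) ≤ 1} := by
    ext x
    have hx : (0 : ℝ) < x := x.2
    have : position P 0 x = 0 ↔ cell 0 x = 0 := by
      have := (P 0).injective.eq_iff (a := cell 0 x) (b := 0)
      rwa [hP.apply_zero] at this
    rw [level, mem_ofPred_eq, mem_ofPred_eq, this, cell_eq_iff]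
    simp [hx]
  have hvol : Measure.comap Subtype.val (volume : Measure ℝ) (level P 0 0) = 1 := by
    have : (Subtype.val '' level P 0 0 : Set ℝ) = Ioc 0 1 := by
      rw [hbase]
      ext y
      constructor
      · rintro ⟨x, hx, rfl⟩
        exact ⟨x.2, hx⟩
      · rintro ⟨h0, h1⟩
        exact ⟨⟨y, h0⟩, h1, rfl⟩
    rw [comap_coe_apply, this]
    simp
  refine ⟨T, spacers, fun n => level P n 0, hasPrescribedHeights_spacers,
    ⟨fun n => by simp [cuts], by simp [hvol], by simp [hvol], fun n => ?_, ?_, fun n => ?_, ?_⟩,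
    hbase⟩
  -- The base of `C n` is cell 0, and its subcells are the cells `0, …, n + 1` of the next grid.
  · have hsub : ∀ k < n + 2, P (n + 1) k = offset n k * scale n := fun k hk => by
      rw [hP.succ n k (hk.trans_le (Nat.le_mul_of_pos_right _ (scale_pos n))),
        Nat.mod_eq_of_lt hk, Nat.div_eq_of_lt hk, hP.apply_zero, add_zero]
    have himage : ∀ k ∈ Finset.range (cuts n),
        T^[subcolumnHeight cuts spacers n k] '' level P (n + 1) 0 = {x | cell (n + 1) x = k} := by
      intro k hk
      rw [Finset.mem_range] at hk
      rw [hlevel _ _ (by rw [← height_spacers]; exact subcolumnHeight_lt cuts_pos hk),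
        subcolumnHeight_spacers, ← hsub k hk]
      ext x
      exact (P (n + 1)).injective.eq_iff
    rw [iUnion₂_congr himage]
    ext x
    simp only [mem_iUnion, mem_ofPred_eq, exists_prop, exists_eq_right', Finset.mem_range, cuts]
    rw [level, mem_ofPred_eq, position, ← hP.apply_zero n, (P n).injective.eq_iff,
      ← cell_succ_div, Nat.div_eq_zero_iff]
    omega
  · refine measurePreserving_of_countable_translations T (D := Set.range fun q : ℕ × ℕ × ℕ =>
      ((q.2.1 : ℝ) - q.2.2) / (q.1 + 1).factorial) (countable_range _) fun x => ?_
    obtain ⟨n, hn⟩ := (hP.eventually_position_add_one_lt x).exists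
    rw [hT n x hn]
    exact ⟨(n, (P n).symm (position P n x + 1), cell n x), by simp [toLevel, toCell]⟩
  · refine ⟨measurableSet_level P n 0, fun i hi j hj hij => ?_⟩
    rw [height_spacers] at hi hj
    rw [hlevel n i hi, hlevel n j hj, Set.disjoint_left]
    exact fun x hx hx' => hij (Eq.trans (Eq.symm hx) hx')
  · intro A hA hAfin ε hε
    obtain ⟨N, hN⟩ := hP.level_approx hA hAfin hε
    refine ⟨N, fun n hn => ?_⟩
    obtain ⟨F, hF, hFε⟩ := hN n hn
    refine ⟨F, by rwa [height_spacers], ?_⟩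
    rwa [iUnion₂_congr fun i hi => hlevel n i (Finset.mem_range.1 (hF hi))]

end Existence

end RankOne

theorem mainTheorem11 :
    -- the transformation exists, on the half-line with Lebesgue measure and `C 0 = (0, 1]`
    (∃ (T : Set.Ioi (0 : ℝ) ≃ᵐ Set.Ioi (0 : ℝ)) (s : ℕ → ℕ → ℕ) (B : ℕ → Set (Set.Ioi (0 : ℝ))),
      RankOne.HasPrescribedHeights s ∧
      RankOne.IsCuttingStacking
        (MeasureTheory.Measure.comap Subtype.val (MeasureTheory.volume : MeasureTheory.Measure ℝ)) T RankOne.cuts s B ∧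
      B 0 = {x : Set.Ioi (0 : ℝ) | (x : ℝ) ≤ 1}) ∧
    -- every realization of it is rank-one, of zero type and multiply recurrent
    (∀ (X : Type*) [MeasurableSpace X] (μ : MeasureTheory.Measure X) [MeasureTheory.SigmaFinite μ]
      (T : X ≃ᵐ X) (s : ℕ → ℕ → ℕ) (B : ℕ → Set X),
      RankOne.HasPrescribedHeights s →
      RankOne.IsCuttingStacking μ T RankOne.cuts s B →
      μ (B 0) = 1 →
      RankOne.IsRankOne μ T ∧ RankOne.IsZeroType μ T ∧ RankOne.IsMultiplyRecurrent μ T) := by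
  refine ⟨RankOne.exists_isCuttingStacking, ?_⟩
  intro X _ μ _ T s B hs h h0
  exact ⟨⟨B, _, h.isRankOneAlong⟩, RankOne.isZeroType h hs h0, RankOne.isMultiplyRecurrent h hs⟩
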